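/- **Setting.** Let $s\ge 2$, $S=\{1,\dots,s\}$, and let $K$ be a connected compact metric space with injective contractions $F_i:K\to K$ $(i\in S)$ such that $K=\bigcup_{i\in S}F_iK$. For a word $w=w_1\cdots w_m\in S^m$ put $F_w=F_{w_1}\circ\cdots\circ F_{w_m}$, and let $\Pi:S^{\mathbb N}\to K$ be given by $\{\Pi(\omega)\}=\bigcap_{m}F_{\omega_1\cdots\omega_m}K$. Let $\mathscr C=\Pi^{-1}\big(\bigcup_{i\ne j}(F_iK\cap F_jK)\big)$ and $\mathscr P=\bigcup_{m\ge1}\sigma^m(\mathscr C)$, where $\sigma$ is the shift, and assume that $\mathscr P$ is finite ($K$ is p.c.f.). Put $V_0=\Pi(\mathscr P)$ and $V_m=\bigcup_{|w|=m}F_wV_0$. Let $(H_0,\mathbf r)$ be a regular harmonic structure: $H_0$ is a symmetric non-positive definite matrix on $V_0$ with non-negative off-diagonal entries whose kernel is exactly the constants, $\mathbf r=(r_1,\dots,r_s)\in(0,1)^s$, and with $\mathscr E_0(u)=-u^{\mathrm t}H_0u$ and $\mathscr E_{m+1}(u)=\sum_{i}r_i^{-1}\mathscr E_m(u\circ F_i)$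 we have $\mathscr E_0(v)=\min\{\mathscr E_1(u):u|_{V_0}=v\}$ for every $v:V_0\to\mathbb R$. Write $r_w=r_{w_1}\cdots r_{w_m}$, $R_wu=(u\circ F_w)|_{V_0}$, $H_m=\sum_{|w|=m}r_w^{-1}R_w^{\mathrm t}H_0R_w$, $\mathscr E(u)=\lim_m\mathscr E_m(u)$ and $\mathscr F=\{u\in C(K):\mathscr E(u)<\infty\}$. Let $\mu_1,\dots,\mu_s\in(0,1)$ with $\sum_i\mu_i=1$ and let $\mu$ be the Borel probability measure on $K$ with $\mu=\sum_i\mu_i\,\mu\circ F_i^{-1}$. For $p\in V_m$ let $\psi_{m,p}$ be the minimizer of $\mathscr E$ over those $u\in\mathscr F$ with $u(p)=1$ and $u=0$ on $V_m\setminus\{p\}$, and let $\mu_{m,p}=\int_K\psi_{m,p}\,d\mu$. For $u,f\in C(K)$, say that $u\in\mathscr D_\mu$ and $\Delta_\mu u=f$ if $\max_{p\in V_m\setminus V_0}|\mu_{m,p}^{-1}(H_mu)(p)-f(p)|\to0$ as $m\to\infty$. For $p\in V_0$ the normal derivative is $(du)_p=\lim_{m\to\infty}-(H_mu)(p)$.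 For $\lambda\ge0$, a $\lambda$-eigenfunction is a $u\in\mathscr D_\mu$, $u\not\equiv0$, with $-\Delta_\mu u=\lambda u$ on $K\setminus V_0$; it is pre-localized if $u(p)=0$ and $(du)_p=0$ for all $p\in V_0$. An extreme set of $u$ is a connected component $A$ of a level set $u^{-1}(c)$ with $A\cap V_0=\emptyset$ such that $u\le c$ on some $\delta$-neighbourhood of $A$, or $u\ge c$ on some $\delta$-neighbourhood of $A$. Let $N(u)\in\{0,1,2,\dots,\infty\}$ be the number of extreme sets of $u$ and $$N(x)=\sup\{N(u):u\text{ is a }\lambda\text{-eigenfunction with }0\le\lambda\le x\}.$$ Put $\gamma_i=\sqrt{r_i\mu_i}$ and let $d_S$ be the unique real number with $\sum_{i}\gamma_i^{d_S}=1$. The lattice case is the case where $\sum_{i}\mathbb Z\log\gamma_i$ is a discrete subgroup of $\mathbb R$. **Proposition.** If there exists a pre-localized eigenfunction, then $$\liminf_{x\to\infty}\frac{\log N(x)}{\log x}\ge\kappa\qquad\text{for some }0<\kappa\le d_S/2 .$$ If moreover we are in the lattice case, then $$\liminf_{x\to\infty}\frac{N(x)}{x^{d_S/2}}>0 .$$ (Both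 quotients are read as $+\infty$ where $N(x)=\infty$.) -/

import Mathlib

open Set Filter Topology MeasureTheory
open scoped ENNReal NNReal

/-- A family of `s` injective contractions `F 0, …, F (s-1)` of a space `K` which is covered by its
images: `K` is the self-similar set (attractor) of the iterated function system. -/
structure SelfSimilarSet (s : ℕ) (K : Type*) [MetricSpace K] where
  F : Fin s → K → K
  two_le : 2 ≤ s
  contracting : ∀ i, ∃ c : ℝ≥0, ContractingWith c (F i)
  injective : ∀ i, Function.Injective (F i)
  cover : (⋃ i, range (F i)) = univ

namespace SelfSimilarSet

variable {s : ℕ} {K : Type*} [MetricSpace K] (D : SelfSimilarSet s K)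

/-- `F_w = F_{w₁} ∘ ⋯ ∘ F_{w_m}` for a finite word `w`; the empty word gives the identity. -/
def Fw : List (Fin s) → K → K
  | [] => id
  | i :: w => D.F i ∘ Fw w

/-- The truncation `ω₁ ⋯ ω_m` of an infinite word. -/
def trunc (ω : ℕ → Fin s) (m : ℕ) : List (Fin s) := List.ofFn fun k : Fin m => ω k

/-- The cell `F_w K` is the image of the whole space; the point with address `ω` lies in every
cell `F_{ω₁ ⋯ ω_m} K`. -/
theorem existsUnique_address [CompactSpace K] [Nonempty K] (ω : ℕ → Fin s) :
    ∃! x : K, ∀ m, x ∈ range (D.Fw (trunc ω m)) := by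
  have hcont : ∀ w, Continuous (D.Fw w) := by
    intro w
    induction w with
    | nil => exact continuous_id
    | cons i w ih =>
      obtain ⟨c, hc⟩ := D.contracting i
      exact hc.2.continuous.comp ih
  have happ : ∀ w v, D.Fw (w ++ v) = D.Fw w ∘ D.Fw v := by
    intro w v
    induction w with
    | nil => rfl
    | cons i w ih =>
      show D.F i ∘ D.Fw (w ++ v) = (D.F i ∘ D.Fw w) ∘ D.Fw v
      rw [ih]; rfl
  choose c hc using D.contracting
  have : Nonempty (Fin s) := ⟨ω 0⟩
  obtain ⟨i₀, hi₀⟩ := Finite.exists_max c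
  have hlip : ∀ w, LipschitzWith (c i₀ ^ w.length) (D.Fw w) := by
    intro w
    induction w with
    | nil => simpa [Fw] using LipschitzWith.id
    | cons i w ih =>
      have h1 := ((hc i).2.weaken (hi₀ i)).comp ih
      rw [List.length_cons, pow_succ']
      exact h1
  have htrunc : ∀ m, trunc ω (m + 1) = trunc ω m ++ [ω m] := by
    intro m
    rw [trunc, List.ofFn_succ_last]
    rfl
  have hne : (⋂ m, range (D.Fw (trunc ω m))).Nonempty := by
    apply IsCompact.nonempty_iInter_of_sequence_nonempty_isCompact_isClosed
    · intro m
      rw [htrunc, happ]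
      exact range_comp_subset_range _ _
    · intro m; exact range_nonempty _
    · exact isCompact_range (hcont _)
    · intro m; exact (isCompact_range (hcont _)).isClosed
  obtain ⟨x, hx⟩ := hne
  rw [mem_iInter] at hx
  refine ⟨x, hx, ?_⟩
  intro y hy
  have hb : ∀ m, dist y x ≤ (c i₀ : ℝ) ^ m * Metric.diam (univ : Set K) := by
    intro m
    obtain ⟨a, ha⟩ := hy m
    obtain ⟨b, hb⟩ := hx m
    have h1 := (hlip (trunc ω m)).dist_le_mul a b
    have h2 : (trunc ω m).length = m := by simp [trunc]
    rw [ha, hb, h2] at h1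
    refine h1.trans ?_
    push_cast
    gcongr
    exact Metric.dist_le_diam_of_mem isCompact_univ.isBounded (mem_univ _) (mem_univ _)
  have hlim : Tendsto (fun m : ℕ => (c i₀ : ℝ) ^ m * Metric.diam (univ : Set K)) atTop (𝓝 0) := by
    have h := (tendsto_pow_atTop_nhds_zero_of_lt_one (c i₀).coe_nonneg
      (by exact_mod_cast (hc i₀).1)).mul_const (Metric.diam (univ : Set K))
    simpa using h
  exact dist_le_zero.1 (ge_of_tendsto' hlim hb)

/-- The coding map `Π : Σ → K`, with `{Π ω} = ⋂ m, F_{ω₁ ⋯ ω_m} K`. -/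
noncomputable def coding [CompactSpace K] [Nonempty K] (ω : ℕ → Fin s) : K :=
  (D.existsUnique_address ω).choose

variable [CompactSpace K] [Nonempty K]

/-- `Π⁻¹ (⋃_{i ≠ j} F_i K ∩ F_j K)`. -/
def criticalSet : Set (ℕ → Fin s) :=
  D.coding ⁻¹' ⋃ (i : Fin s) (j : Fin s) (_ : i ≠ j), range (D.F i) ∩ range (D.F j)

/-- `⋃_{m ≥ 1} σ^m (criticalSet)`, where `σ` is the left shift. -/
def postCriticalSet : Set (ℕ → Fin s) :=
  ⋃ (m : ℕ) (_ : 1 ≤ m), (fun (ω : ℕ → Fin s) (k : ℕ) => ω (k + m)) '' D.criticalSet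

/-- The boundary `V₀ = Π (postCriticalSet)` of `K`. -/
def V₀ : Set K := D.coding '' D.postCriticalSet

/-- `V_m = ⋃_{|w| = m} F_w V₀`. -/
def V (m : ℕ) : Set K := ⋃ w : Fin m → Fin s, D.Fw (List.ofFn w) '' D.V₀

end SelfSimilarSet

/-- A post-critically finite self-similar set. -/
structure PCFSet (s : ℕ) (K : Type*) [MetricSpace K] [CompactSpace K] [Nonempty K] extends
    SelfSimilarSet s K where
  finite_postCritical : toSelfSimilarSet.postCriticalSet.Finite

noncomputable instance PCFSet.instFintypeBoundary {s : ℕ} {K : Type*} [MetricSpace K]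
    [CompactSpace K] [Nonempty K] (D : PCFSet s K) : Fintype D.V₀ :=
  (D.finite_postCritical.image _).fintype

/-- `H` is a discrete Laplacian on the finite set `V`. -/
structure IsDiscreteLaplacian {V : Type*} [Fintype V] (H : Matrix V V ℝ) : Prop where
  symm : H.IsSymm
  nonpos : ∀ u : V → ℝ, u ⬝ᵥ H.mulVec u ≤ 0
  ker : ∀ u : V → ℝ, H.mulVec u = 0 ↔ ∃ c : ℝ, ∀ p, u p = c
  offDiag_nonneg : ∀ p q, p ≠ q → 0 ≤ H p q

/-- `𝓔_m (u)`, depending only on `u` restricted to `V_m`: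
`𝓔₀ (u) = - uᵗ H u` on `V₀` and `𝓔_{m+1} (u) = ∑ i, r_i⁻¹ 𝓔_m (u ∘ F_i)`. -/
noncomputable def PCFSet.levelEnergy {s : ℕ} {K : Type*} [MetricSpace K] [CompactSpace K]
    [Nonempty K] (D : PCFSet s K) (H : Matrix D.V₀ D.V₀ ℝ) (r : Fin s → ℝ) :
    ℕ → (K → ℝ) → ℝ
  | 0, u => -((fun p : D.V₀ => u p) ⬝ᵥ H.mulVec (fun p : D.V₀ => u p))
  | m + 1, u => ∑ i, (r i)⁻¹ * levelEnergy D H r m (u ∘ D.F i)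

/-- A regular harmonic structure `(H, r)` on a p.c.f. self-similar set. Functions on `V₁` are
represented by functions on `K`, of which only the values on `V₁` matter. -/
structure RegularHarmonicStructure {s : ℕ} {K : Type*} [MetricSpace K] [CompactSpace K]
    [Nonempty K] (D : PCFSet s K) where
  H : Matrix D.V₀ D.V₀ ℝ
  isLaplacian : IsDiscreteLaplacian H
  r : Fin s → ℝ
  r_pos : ∀ i, 0 < r i
  r_lt_one : ∀ i, r i < 1
  harmonic : ∀ v : D.V₀ → ℝ,
    IsLeast {e : ℝ | ∃ u : K → ℝ, (∀ p : D.V₀, u p = v p) ∧ e = D.levelEnergy H r 1 u}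
      (-(v ⬝ᵥ H.mulVec v))

/-- Strictly positive probability weights on the symbols. Since `2 ≤ s`, each lies in `(0, 1)`. -/
structure ProbWeights (s : ℕ) where
  wt : Fin s → ℝ
  pos : ∀ i, 0 < wt i
  lt_one : ∀ i, wt i < 1
  sum_eq_one : ∑ i, wt i = 1

/-- `μ` is the self-similar probability measure with weights `M`: `μ = ∑ i, μ_i • (μ ∘ F_i⁻¹)`. -/
def SelfSimilarSet.IsSelfSimilarMeasure {s : ℕ} {K : Type*} [MetricSpace K] [MeasurableSpace K]
    (D : SelfSimilarSet s K) (M : ProbWeights s) (μ : Measure K) : Prop :=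
  IsProbabilityMeasure μ ∧ μ = ∑ i, ENNReal.ofReal (M.wt i) • μ.map (D.F i)

namespace RegularHarmonicStructure

variable {s : ℕ} {K : Type*} [MetricSpace K] [CompactSpace K] [Nonempty K] {D : PCFSet s K}
  (E : RegularHarmonicStructure D)

/-- `𝓔 (u) = lim_m 𝓔_m (u)`; the sequence is nonnegative and nondecreasing, so that the limit is
its supremum in `[0, ∞]`. -/
noncomputable def energy (u : C(K, ℝ)) : ℝ≥0∞ :=
  ⨆ m, ENNReal.ofReal (D.levelEnergy E.H E.r m u)

/-- The domain of the energy, as a set of continuous functions. -/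
def domain : Set C(K, ℝ) := {u | E.energy u < ∞}

open Classical in
/-- `(H_m u) (p)`, where `H_m = ∑_{|w| = m} r_w⁻¹ R_wᵗ H R_w` and `R_w u = (u ∘ F_w)|_{V₀}`. -/
noncomputable def Hm (m : ℕ) (u : K → ℝ) (p : K) : ℝ :=
  ∑ w : Fin m → Fin s, (∏ k, E.r (w k))⁻¹ *
    ∑ q : D.V₀, if D.Fw (List.ofFn w) q = p
      then E.H.mulVec (fun q' : D.V₀ => u (D.Fw (List.ofFn w) q')) q else 0

/-- The competitors for `ψ_{m,p}`: functions of finite energy with values `1` at `p` and `0` at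
the other points of `V_m`. -/
def tentClass (m : ℕ) (p : K) : Set C(K, ℝ) :=
  {u | u ∈ E.domain ∧ u p = 1 ∧ ∀ q ∈ D.V m, q ≠ p → u q = 0}

/-- `ψ_{m,p}`, the (unique) energy minimizer among `tentClass m p`. -/
noncomputable def tent (m : ℕ) (p : K) : C(K, ℝ) :=
  Classical.epsilon fun ψ : C(K, ℝ) =>
    ψ ∈ E.tentClass m p ∧ ∀ u ∈ E.tentClass m p, E.energy ψ ≤ E.energy u

/-- The normal derivative `(du)_p = lim_m -(H_m u) (p)` exists and equals `a`. -/
def HasNormalDeriv (u : C(K, ℝ)) (p : K) (a : ℝ) : Prop :=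
  Tendsto (fun m => -E.Hm m u p) atTop (𝓝 a)

variable [MeasurableSpace K]

/-- `u` is in the domain of the `μ`-Laplacian and `Δ_μ u = f`:
`max_{p ∈ V_m ∖ V₀} |μ_{m,p}⁻¹ (H_m u) (p) - f (p)| → 0`, where `μ_{m,p} = ∫ ψ_{m,p} dμ`. -/
def HasLaplacian (μ : Measure K) (u f : C(K, ℝ)) : Prop :=
  ∀ ε > 0, ∀ᶠ m in atTop, ∀ p ∈ D.V m \ D.V₀,
    |(∫ x, E.tent m p x ∂μ)⁻¹ * E.Hm m u p - f p| < ε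

/-- `u` is a `lam`-eigenfunction of `-Δ_μ`: a nontrivial solution of `-Δ_μ u = lam * u` on
`K ∖ V₀`, without any boundary condition. -/
def IsEigenfunction (μ : Measure K) (lam : ℝ) (u : C(K, ℝ)) : Prop :=
  u ≠ 0 ∧ ∃ f : C(K, ℝ), E.HasLaplacian μ u f ∧ ∀ x ∉ D.V₀, -f x = lam * u x

/-- An eigenfunction that vanishes on the boundary together with its normal derivatives. -/
def IsPreLocalized (μ : Measure K) (lam : ℝ) (u : C(K, ℝ)) : Prop :=
  E.IsEigenfunction μ lam u ∧ (∀ p ∈ D.V₀, u p = 0) ∧ ∀ p ∈ D.V₀, E.HasNormalDeriv u p 0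

end RegularHarmonicStructure

section Extrema

variable {s : ℕ} {K : Type*} [MetricSpace K] [CompactSpace K] [Nonempty K]

/-- `A` is a connected component of the level set `{u = c}`, for some `c`, which misses `V₀`, and
`u ≤ c` (or `u ≥ c`) on some `δ`-neighbourhood of `A`. -/
def PCFSet.IsExtremeSet (D : PCFSet s K) (u : C(K, ℝ)) (A : Set K) : Prop :=
  ∃ c : ℝ, (∃ x ∈ u ⁻¹' {c}, A = connectedComponentIn (u ⁻¹' {c}) x) ∧ A ∩ D.V₀ = ∅ ∧
    ∃ δ > 0, (∀ p ∈ Metric.thickening δ A, u p ≤ c) ∨ (∀ p ∈ Metric.thickening δ A, c ≤ u p)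

/-- `N(u)`, the number of extreme sets of `u` (possibly infinite). -/
noncomputable def PCFSet.numExtreme (D : PCFSet s K) (u : C(K, ℝ)) : ℕ∞ :=
  {A : Set K | D.IsExtremeSet u A}.encard

/-- The extremum counting function `N(x)`, the supremum of `N(u)` over all eigenfunctions `u` of
`-Δ_μ` with eigenvalue in `[0, x]`. -/
noncomputable def RegularHarmonicStructure.extremumCount {D : PCFSet s K}
    (E : RegularHarmonicStructure D) [MeasurableSpace K] (μ : Measure K) (x : ℝ) : ℕ∞ :=
  sSup {n | ∃ (lam : ℝ) (u : C(K, ℝ)), 0 ≤ lam ∧ lam ≤ x ∧ E.IsEigenfunction μ lam u ∧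
    n = D.numExtreme u}

end Extrema

namespace RegularHarmonicStructure

variable {s : ℕ} {K : Type*} [MetricSpace K] [CompactSpace K] [Nonempty K] {D : PCFSet s K}
  (E : RegularHarmonicStructure D) (M : ProbWeights s)

/-- `γ_i = √(r_i μ_i)`. -/
noncomputable def γ (i : Fin s) : ℝ := √(E.r i * M.wt i)

theorem existsUnique_spectralExponent : ∃! d : ℝ, ∑ i, E.γ M i ^ d = 1 := by
  have h0 : ∀ i, 0 < E.γ M i := fun i => Real.sqrt_pos.2 (mul_pos (E.r_pos i) (M.pos i))
  have h1 : ∀ i, E.γ M i < 1 := by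
    intro i
    refine (Real.sqrt_lt' one_pos).2 ?_
    have := mul_lt_mul'' (E.r_lt_one i) (M.lt_one i) (E.r_pos i).le (M.pos i).le
    simpa using this
  have hs := D.two_le
  have : Nonempty (Fin s) := ⟨⟨0, by omega⟩⟩
  have hanti : StrictAnti fun d : ℝ => ∑ i, E.γ M i ^ d := by
    intro a b hab
    exact Finset.sum_lt_sum_of_nonempty Finset.univ_nonempty
      fun i _ => Real.rpow_lt_rpow_of_exponent_gt (h0 i) (h1 i) hab
  have hcont : Continuous fun d : ℝ => ∑ i, E.γ M i ^ d :=
    continuous_finsetSum _ fun i _ => Real.continuous_const_rpow (h0 i).ne'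
  have hlim : Tendsto (fun d : ℝ => ∑ i, E.γ M i ^ d) atTop (𝓝 0) := by
    have := tendsto_finsetSum (Finset.univ : Finset (Fin s)) fun i _ =>
      tendsto_rpow_atTop_of_base_lt_one (E.γ M i) (by linarith [h0 i]) (h1 i)
    simpa using this
  obtain ⟨b, hb⟩ := (hlim.eventually (gt_mem_nhds (zero_lt_one))).exists
  obtain ⟨d, hd⟩ := mem_range_of_exists_le_of_exists_ge hcont (c := 1) ⟨b, hb.le⟩
    ⟨0, by simpa using (by omega : 1 ≤ s)⟩
  exact ⟨d, hd, fun y hy => hanti.injective (hy.trans hd.symm)⟩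

/-- The spectral exponent `d_S`, with `∑ i, γ_i ^ d_S = 1`. -/
noncomputable def spectralExponent : ℝ := (E.existsUnique_spectralExponent M).choose

/-- The lattice case: `∑ i, ℤ log γ_i` is a discrete subgroup of `ℝ`. -/
def IsLattice : Prop :=
  DiscreteTopology (AddSubgroup.closure (range fun i => Real.log (E.γ M i)))

end RegularHarmonicStructure

/-!
A pre-localized eigenfunction can be copied, scaled, into any cell of `K` and extended by zero: the
copy in the cell `F_w K` is a pre-localized eigenfunction with eigenvalue `lam / (r_w μ_w)`. Sums of
copies over disjoint cells with the same scaling factor `r_w μ_w = γ_w²` are again eigenfunctions,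
and each copy contributes at least one extreme set, a component of the set where the maximum is
attained. So the extremum counting function is bounded below by numbers of words with prescribed
scaling factor. The words of length `2n` made of the blocks `ij` and `ji` give `2 ^ n` copies at an
eigenvalue that grows exponentially in `n`, which is the power lower bound. In the lattice case the
`log γ_i` are negative multiples `-a (ν_i + 1)` of one number, the number of words with
`γ_w = exp (-a n)` solves a renewal equation with root `d_S`, and the conserved quantity of that
equation shows that it is at least a constant times `exp (a d_S n)` along a sequence of `n` with
bounded gaps.

Copies need only be placed one level at a time (`IsLocalized.of_comp_F`, `PeaksAt.sum`), so no
combinatorics of words is needed. The analytic point is that gluing preserves the equation at the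
junction points, where the glued function vanishes. There the discrete normal derivatives of the
pieces must be small compared with the masses of the tent functions, which themselves tend to `0`.
This is `IsLocalized.eventually_abs_Hm_le`: summation by parts expresses `H_m u (p)` at a boundary
point through the values `H_n u (q)` of finer levels weighted with the tent function `ψ_{m,p}`, and
these are controlled by the equation and by the vanishing of `u` at `p`.

That argument uses the description of tent functions as the continuous functions that are harmonic
outside `V_m` with prescribed values on `V_m` (`tent_spec`). Existence of such functions
(`exists_piecewiseHarmonic`) comes from iterating the discrete Dirichlet problem from `V₀` to `V₁`:
as all `r_i < 1`, the energy of a harmonic function on small cells, and with it its oscillation,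
decays geometrically. Uniqueness and positivity are propagated from one level to the next, starting
from the discrete problem, where connectedness of `K` and the signs of the off-diagonal entries
enter.
-/

/-! ### Self-similar sets: addresses, cells and gluing -/

namespace SelfSimilarSet

variable {s : ℕ} {K : Type*} [MetricSpace K] (D : SelfSimilarSet s K)

theorem continuous_F (i : Fin s) : Continuous (D.F i) := by
  obtain ⟨c, hc⟩ := D.contracting i
  exact hc.2.continuous

theorem exists_eq_F (x : K) : ∃ i y, D.F i y = x := by
  have h : x ∈ ⋃ i, range (D.F i) := by rw [D.cover]; trivial
  simpa using h

/-- A common contraction ratio of all the maps. -/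
theorem exists_ratio : ∃ c : ℝ≥0, c < 1 ∧ ∀ i, LipschitzWith c (D.F i) := by
  choose c hc using D.contracting
  have hs := D.two_le
  have : Nonempty (Fin s) := ⟨⟨0, by omega⟩⟩
  obtain ⟨j, hj⟩ := Finite.exists_max c
  exact ⟨c j, (hc j).1, fun i => (hc i).2.weaken (hj i)⟩

theorem dist_F_le {c : ℝ≥0} (hc : ∀ i, LipschitzWith c (D.F i)) (i : Fin s) (n : ℕ) {x y : K}
    (h : dist x y ≤ (c : ℝ) ^ n * Metric.diam (univ : Set K)) :
    dist (D.F i x) (D.F i y) ≤ (c : ℝ) ^ (n + 1) * Metric.diam (univ : Set K) := by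
  refine ((hc i).dist_le_mul x y).trans ?_
  rw [pow_succ', mul_assoc]
  gcongr

theorem tendsto_ratio_pow_mul_diam {c : ℝ≥0} (hc : c < 1) :
    Tendsto (fun n : ℕ => (c : ℝ) ^ n * Metric.diam (univ : Set K)) atTop (𝓝 0) := by
  have h := (tendsto_pow_atTop_nhds_zero_of_lt_one c.coe_nonneg
    (by exact_mod_cast hc)).mul_const (Metric.diam (univ : Set K))
  simpa using h

variable [CompactSpace K]

theorem dist_le_diam_univ (x y : K) : dist x y ≤ Metric.diam (univ : Set K) :=
  Metric.dist_le_diam_of_mem isCompact_univ.isBounded (mem_univ _) (mem_univ _)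

/-- Continuous functions on the cells `F_i K`, pulled back to `K`, that agree on overlaps come from
a continuous function on `K`. -/
theorem exists_glue (v : Fin s → C(K, ℝ))
    (hv : ∀ i j x y, D.F i x = D.F j y → v i x = v j y) :
    ∃ u : C(K, ℝ), ∀ i x, u (D.F i x) = v i x := by
  let f : (Σ _ : Fin s, K) → K := fun z => D.F z.1 z.2
  have hf : Continuous f := continuous_sigma fun i => D.continuous_F i
  have hsurj : Function.Surjective f := fun x => by
    obtain ⟨i, y, h⟩ := D.exists_eq_F x
    exact ⟨⟨i, y⟩, h⟩
  have hq : IsQuotientMap f := hf.isClosedMap.isQuotientMap hf hsurj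
  let g : (Σ _ : Fin s, K) → ℝ := fun z => v z.1 z.2
  have hg : Continuous g := continuous_sigma fun i => (v i).continuous
  have hgf : ∀ z, g (Function.surjInv hsurj (f z)) = g z := fun z =>
    hv _ _ _ _ (Function.surjInv_eq hsurj (f z))
  refine ⟨⟨fun x => g (Function.surjInv hsurj x), hq.continuous_iff.2 ?_⟩, fun i x => hgf ⟨i, x⟩⟩
  exact hg.congr fun z => (hgf z).symm

open Classical in
/-- The continuous function that is `v i ∘ F_i⁻¹` on the cell `F_i K`, and the junk value `0` if
these do not agree on the overlaps. -/
noncomputable def glue (v : Fin s → C(K, ℝ)) : C(K, ℝ) :=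
  if h : ∃ u : C(K, ℝ), ∀ i x, u (D.F i x) = v i x then h.choose else 0

theorem glue_apply {v : Fin s → C(K, ℝ)}
    (hv : ∀ i j x y, D.F i x = D.F j y → v i x = v j y) (i : Fin s) (x : K) :
    D.glue v (D.F i x) = v i x := by
  have h := D.exists_glue v hv
  rw [glue, dif_pos h]
  exact h.choose_spec i x

/-- In a connected self-similar set, a nonempty set of symbols that contains every symbol whose
cell meets a cell of the set contains all symbols. -/
theorem mem_of_overlap_closed [ConnectedSpace K] (I : Set (Fin s)) (hI : I.Nonempty)
    (h : ∀ i ∈ I, ∀ j x y, D.F i x = D.F j y → j ∈ I) (j : Fin s) : j ∈ I := by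
  have hcl : ∀ J : Set (Fin s), IsClosed (⋃ i ∈ J, range (D.F i)) := fun J =>
    (toFinite J).isClosed_biUnion fun i _ => (isCompact_range (D.continuous_F i)).isClosed
  have hcompl : (⋃ i ∈ I, range (D.F i))ᶜ = ⋃ i ∈ Iᶜ, range (D.F i) := by
    ext x
    simp only [mem_compl_iff, mem_iUnion, mem_range, not_exists, exists_prop]
    constructor
    · intro hx
      obtain ⟨i, y, rfl⟩ := D.exists_eq_F x
      exact ⟨i, fun hi => hx i ⟨hi, y, rfl⟩, y, rfl⟩
    · rintro ⟨i, hi, y, rfl⟩ j ⟨hj, z, hz⟩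
      exact hi (h j hj i z y hz)
  have hclopen : IsClopen (⋃ i ∈ I, range (D.F i)) :=
    ⟨hcl I, by rw [← isClosed_compl_iff, hcompl]; exact hcl _⟩
  obtain ⟨i₀, hi₀⟩ := hI
  have x₀ : K := Classical.arbitrary K
  have huniv := hclopen.eq_univ ⟨D.F i₀ x₀, mem_biUnion hi₀ ⟨x₀, rfl⟩⟩
  have : D.F j x₀ ∈ ⋃ i ∈ I, range (D.F i) := by rw [huniv]; trivial
  simp only [mem_iUnion, mem_range, exists_prop] at this
  obtain ⟨i, hi, y, hy⟩ := this
  exact h i hi j y x₀ hy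

variable [Nonempty K]

theorem coding_mem (ω : ℕ → Fin s) (m : ℕ) : D.coding ω ∈ range (D.Fw (trunc ω m)) :=
  (D.existsUnique_address ω).choose_spec.1 m

theorem eq_coding {ω : ℕ → Fin s} {x : K} (h : ∀ m, x ∈ range (D.Fw (trunc ω m))) :
    D.coding ω = x :=
  ((D.existsUnique_address ω).choose_spec.2 x h).symm

theorem trunc_succ (ω : ℕ → Fin s) (m : ℕ) :
    trunc ω (m + 1) = ω 0 :: trunc (fun k => ω (k + 1)) m := by
  simp [trunc, List.ofFn_succ]

theorem coding_eq (ω : ℕ → Fin s) :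
    D.coding ω = D.F (ω 0) (D.coding fun k => ω (k + 1)) := by
  apply D.eq_coding
  rintro (_ | m)
  · exact ⟨_, rfl⟩
  · obtain ⟨y, hy⟩ := D.coding_mem (fun k => ω (k + 1)) m
    exact ⟨y, by rw [trunc_succ, ← hy]; rfl⟩

theorem coding_surjective : Function.Surjective D.coding := by
  intro x
  choose a b hab using D.exists_eq_F
  have key : ∀ (m : ℕ) (x : K), x ∈ range (D.Fw (trunc (fun k : ℕ => a (b^[k] x)) m)) := by
    intro m
    induction m with
    | zero => exact fun x => ⟨x, rfl⟩
    | succ m ih =>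
      intro x
      obtain ⟨y, hy⟩ := ih (b x)
      refine ⟨y, ?_⟩
      rw [trunc_succ]
      calc D.F (a x) (D.Fw (trunc (fun k => a (b^[k] (b x))) m) y) = D.F (a x) (b x) := by rw [hy]
        _ = x := hab x
  exact ⟨_, D.eq_coding fun m => key m x⟩

/-- A point of an overlap of two cells has boundary points as its preimages. -/
theorem mem_V₀_of_overlap {i j : Fin s} (hij : i ≠ j) {x y : K} (h : D.F i x = D.F j y) :
    x ∈ D.V₀ := by
  obtain ⟨ω, rfl⟩ := D.coding_surjective x
  let τ : ℕ → Fin s := fun k => Nat.casesOn k i ω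
  have hτ : D.coding τ = D.F i (D.coding ω) := D.coding_eq τ
  refine ⟨ω, mem_iUnion₂.2 ⟨1, le_rfl, τ, ?_, rfl⟩, rfl⟩
  rw [criticalSet, mem_preimage, hτ]
  exact mem_iUnion.2 ⟨i, mem_iUnion.2 ⟨j, mem_iUnion.2 ⟨hij, ⟨_, rfl⟩, ⟨y, h.symm⟩⟩⟩⟩

theorem exists_F_eq_of_mem_V₀ {p : K} (hp : p ∈ D.V₀) : ∃ i, ∃ q ∈ D.V₀, D.F i q = p := by
  obtain ⟨ω, hω, rfl⟩ := hp
  obtain ⟨m, hm, τ, hτ, rfl⟩ := mem_iUnion₂.1 hω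
  refine ⟨_, _, ?_, (D.coding_eq _).symm⟩
  refine ⟨_, mem_iUnion₂.2 ⟨m + 1, by omega, τ, hτ, ?_⟩, rfl⟩
  funext k
  show τ (k + (m + 1)) = τ (k + 1 + m)
  congr 1; omega

theorem mem_V₀_of_F_mem_V₀ {i : Fin s} {q : K} (h : D.F i q ∈ D.V₀) : q ∈ D.V₀ := by
  obtain ⟨j, q', hq', e⟩ := D.exists_F_eq_of_mem_V₀ h
  by_cases hij : i = j
  · subst hij
    rwa [← D.injective i e]
  · exact D.mem_V₀_of_overlap hij e.symm

theorem V_zero : D.V 0 = D.V₀ := by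
  ext x; simp [V, Fw]

theorem V_succ (m : ℕ) : D.V (m + 1) = ⋃ i, D.F i '' D.V m := by
  ext x
  simp only [V, mem_iUnion, mem_image]
  constructor
  · rintro ⟨w, q, hq, rfl⟩
    refine ⟨w 0, _, ⟨fun k => w k.succ, q, hq, rfl⟩, ?_⟩
    rw [List.ofFn_succ]; rfl
  · rintro ⟨i, _, ⟨w, q, hq, rfl⟩, rfl⟩
    refine ⟨Fin.cons i w, q, hq, ?_⟩
    rw [List.ofFn_succ]; rfl

theorem F_mem_V_succ {m : ℕ} (i : Fin s) {x : K} (hx : x ∈ D.V m) : D.F i x ∈ D.V (m + 1) := by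
  rw [V_succ]; exact mem_iUnion.2 ⟨i, x, hx, rfl⟩

theorem exists_of_mem_V_succ {m : ℕ} {x : K} (hx : x ∈ D.V (m + 1)) :
    ∃ i, ∃ y ∈ D.V m, D.F i y = x := by
  rw [V_succ] at hx; simpa using hx

theorem V_subset_V_succ (m : ℕ) : D.V m ⊆ D.V (m + 1) := by
  induction m with
  | zero =>
    intro p hp
    rw [V_zero] at hp
    obtain ⟨i, q, hq, rfl⟩ := D.exists_F_eq_of_mem_V₀ hp
    exact D.F_mem_V_succ i (by rwa [V_zero])
  | succ m ih =>
    intro p hp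
    obtain ⟨i, q, hq, rfl⟩ := D.exists_of_mem_V_succ hp
    exact D.F_mem_V_succ i (ih hq)

theorem V_mono : Monotone D.V := monotone_nat_of_le_succ D.V_subset_V_succ

theorem V₀_subset_V (m : ℕ) : D.V₀ ⊆ D.V m := by
  rw [← V_zero]; exact D.V_mono m.zero_le

theorem V₀_nonempty [ConnectedSpace K] : D.V₀.Nonempty := by
  by_contra hne
  have hs := D.two_le
  have h := D.mem_of_overlap_closed {⟨0, by omega⟩} (singleton_nonempty _) (fun i hi j x y e => by
    by_contra hj
    refine hne ⟨x, D.mem_V₀_of_overlap (i := i) (j := j) ?_ e⟩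
    rintro rfl
    exact hj hi) ⟨1, by omega⟩
  simp at h

/-- The vertices of level `n` are dense in `K` up to the size of the cells of level `n`. -/
theorem exists_mem_V_dist_le [ConnectedSpace K] {c : ℝ≥0} (hc : ∀ i, LipschitzWith c (D.F i))
    (n : ℕ) (x : K) : ∃ y ∈ D.V n, dist x y ≤ (c : ℝ) ^ n * Metric.diam (univ : Set K) := by
  induction n generalizing x with
  | zero =>
    obtain ⟨p, hp⟩ := D.V₀_nonempty
    exact ⟨p, by rwa [V_zero], by simpa using dist_le_diam_univ x p⟩
  | succ n ih =>
    obtain ⟨i, z, rfl⟩ := D.exists_eq_F x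
    obtain ⟨y, hy, hd⟩ := ih z
    exact ⟨D.F i y, D.F_mem_V_succ i hy, D.dist_F_le hc i n hd⟩

/-- A closed set that contains all vertices of high levels is everything. -/
theorem mem_of_isClosed [ConnectedSpace K] {Z : Set K} (hZ : IsClosed Z) {m : ℕ}
    (h : ∀ n, m ≤ n → D.V n ⊆ Z) (x : K) : x ∈ Z := by
  obtain ⟨c, hc1, hc⟩ := D.exists_ratio
  choose y hy hd using fun n => D.exists_mem_V_dist_le hc n x
  have hlim : Tendsto y atTop (𝓝 x) := by
    rw [tendsto_iff_dist_tendsto_zero]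
    refine squeeze_zero (fun _ => dist_nonneg) (fun n => ?_)
      (tendsto_ratio_pow_mul_diam (K := K) hc1)
    rw [dist_comm]
    exact hd n
  refine hZ.mem_of_tendsto hlim ?_
  filter_upwards [eventually_ge_atTop m] with n hn using h n hn (hy n)

theorem compatible_of_boundary {v : Fin s → C(K, ℝ)}
    (h : ∀ i j, ∀ x ∈ D.V₀, ∀ y ∈ D.V₀, D.F i x = D.F j y → v i x = v j y)
    (i j : Fin s) (x y : K) (e : D.F i x = D.F j y) : v i x = v j y := by
  by_cases hij : i = j
  · subst hij
    rw [D.injective i e]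
  · exact h i j x (D.mem_V₀_of_overlap hij e) y (D.mem_V₀_of_overlap (Ne.symm hij) e.symm) e

end SelfSimilarSet

namespace PCFSet

variable {s : ℕ} {K : Type*} [MetricSpace K] [CompactSpace K] [Nonempty K] (D : PCFSet s K)

theorem finite_V (m : ℕ) : (D.V m).Finite := by
  induction m with
  | zero => rw [SelfSimilarSet.V_zero]; exact D.finite_postCritical.image _
  | succ m ih =>
    rw [SelfSimilarSet.V_succ]
    exact finite_iUnion fun i => ih.image _

end PCFSet

/-! ### The energy forms and discrete harmonic functions -/

namespace RegularHarmonicStructure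

variable {s : ℕ} {K : Type*} [MetricSpace K] [CompactSpace K] [Nonempty K] {D : PCFSet s K}
  (E : RegularHarmonicStructure D)

open Classical in
/-- The bilinear form of the level-`n` energy `𝓔_n`, on arbitrary functions on `K`, of which only
the values on `V_n` matter. -/
noncomputable def form : ℕ → LinearMap.BilinForm ℝ (K → ℝ)
  | 0 => -(Matrix.toBilin' E.H).compl₁₂ (LinearMap.funLeft ℝ ℝ Subtype.val)
      (LinearMap.funLeft ℝ ℝ Subtype.val)
  | n + 1 => ∑ i, (E.r i)⁻¹ • (form n).compl₁₂ (LinearMap.funLeft ℝ ℝ (D.F i))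
      (LinearMap.funLeft ℝ ℝ (D.F i))

theorem form_zero (u v : K → ℝ) :
    E.form 0 u v = -((fun p : D.V₀ => u p) ⬝ᵥ E.H.mulVec fun p : D.V₀ => v p) := by
  classical
  rw [form, LinearMap.neg_apply, LinearMap.neg_apply, LinearMap.compl₁₂_apply,
    Matrix.toBilin'_apply']
  rfl

theorem form_succ (n : ℕ) (u v : K → ℝ) :
    E.form (n + 1) u v = ∑ i, (E.r i)⁻¹ * E.form n (u ∘ D.F i) (v ∘ D.F i) := by
  rw [form, LinearMap.sum_apply, LinearMap.sum_apply]
  rfl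

theorem levelEnergy_eq_form (n : ℕ) (u : K → ℝ) :
    D.levelEnergy E.H E.r n u = E.form n u u := by
  induction n generalizing u with
  | zero => rw [form_zero]; rfl
  | succ n ih =>
    rw [form_succ, PCFSet.levelEnergy]
    simp only [ih]

theorem form_congr {n : ℕ} {u u' v v' : K → ℝ} (hu : EqOn u u' (D.V n)) (hv : EqOn v v' (D.V n)) :
    E.form n u v = E.form n u' v' := by
  induction n generalizing u u' v v' with
  | zero =>
    rw [SelfSimilarSet.V_zero] at hu hv
    have h1 : (fun p : D.V₀ => u p) = fun p : D.V₀ => u' p := funext fun p => hu p.2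
    have h2 : (fun p : D.V₀ => v p) = fun p : D.V₀ => v' p := funext fun p => hv p.2
    rw [form_zero, form_zero, h1, h2]
  | succ n ih =>
    rw [form_succ, form_succ]
    refine Finset.sum_congr rfl fun i _ => ?_
    rw [ih (u := u ∘ D.F i) (v := v ∘ D.F i) (fun x hx => hu (D.F_mem_V_succ i hx))
      fun x hx => hv (D.F_mem_V_succ i hx)]
    rfl

theorem form_comm (n : ℕ) (u v : K → ℝ) : E.form n u v = E.form n v u := by
  induction n generalizing u v with
  | zero =>
    rw [form_zero, form_zero, Matrix.dotProduct_mulVec, ← Matrix.mulVec_transpose,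
      E.isLaplacian.symm.eq, dotProduct_comm]
  | succ n ih =>
    rw [form_succ, form_succ]
    exact Finset.sum_congr rfl fun i _ => by rw [ih]

theorem form_self_nonneg (n : ℕ) (u : K → ℝ) : 0 ≤ E.form n u u := by
  induction n generalizing u with
  | zero => rw [form_zero]; exact neg_nonneg.2 (E.isLaplacian.nonpos _)
  | succ n ih =>
    rw [form_succ]
    exact Finset.sum_nonneg fun i _ => mul_nonneg (inv_nonneg.2 (E.r_pos i).le) (ih _)

theorem form_sq_le (n : ℕ) (u v : K → ℝ) : E.form n u v ^ 2 ≤ E.form n u u * E.form n v v :=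
  LinearMap.BilinForm.apply_sq_le_of_symm _ (E.form_self_nonneg n) ⟨fun u v => by
    simpa using E.form_comm n u v⟩ u v

theorem form_eq_zero_of_self {n : ℕ} {u : K → ℝ} (h : E.form n u u = 0) (v : K → ℝ) :
    E.form n u v = 0 := by
  have := E.form_sq_le n u v
  rw [h, zero_mul] at this
  exact pow_eq_zero_iff two_ne_zero |>.1 (le_antisymm this (sq_nonneg _))

/-- Functions of zero energy on `V₀` are constant there. -/
theorem eq_of_form_zero_eq_zero {u : K → ℝ} (h : E.form 0 u u = 0) {p q : K} (hp : p ∈ D.V₀)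
    (hq : q ∈ D.V₀) : u p = u q := by
  have hH : E.H.mulVec (fun p : D.V₀ => u p) = 0 := by
    set w := E.H.mulVec fun p : D.V₀ => u p with hw
    have h1 := E.form_eq_zero_of_self h (Function.extend Subtype.val w 0)
    rw [form_comm, form_zero, ← hw] at h1
    have h2 : (fun p : D.V₀ => Function.extend Subtype.val w 0 (p : K)) = w :=
      funext fun p => Subtype.val_injective.extend_apply _ _ p
    rw [h2, neg_eq_zero] at h1
    exact dotProduct_self_eq_zero.1 h1
  obtain ⟨c, hc⟩ := (E.isLaplacian.ker _).1 hH
  exact (hc ⟨p, hp⟩).trans (hc ⟨q, hq⟩).symm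

/-- The energy on `V₀` controls differences of boundary values (finite effective resistance). -/
theorem exists_resistance_bound :
    ∃ C : ℝ, 0 ≤ C ∧ ∀ u : K → ℝ, ∀ p ∈ D.V₀, ∀ q ∈ D.V₀,
      (u p - u q) ^ 2 ≤ C * E.form 0 u u := by
  classical
  -- The functional `v p - v q` vanishes on the kernel of `H`, hence factors through `H`.
  have key : ∀ p q : D.V₀, ∃ g : D.V₀ → ℝ, ∀ v : D.V₀ → ℝ, v p - v q = g ⬝ᵥ E.H.mulVec v := by
    intro p q
    let l : Module.Dual ℝ (D.V₀ → ℝ) := LinearMap.proj (R := ℝ) (φ := fun _ : D.V₀ => ℝ) p -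
      LinearMap.proj (R := ℝ) (φ := fun _ : D.V₀ => ℝ) q
    have hl : l ∈ LinearMap.range (Matrix.toLin' E.H).dualMap := by
      rw [LinearMap.range_dualMap_eq_dualAnnihilator_ker, Submodule.mem_dualAnnihilator]
      intro w hw
      rw [LinearMap.mem_ker, Matrix.toLin'_apply] at hw
      obtain ⟨c, hc⟩ := (E.isLaplacian.ker w).1 hw
      simp [l, hc]
    obtain ⟨φ, hφ⟩ := hl
    refine ⟨fun a => φ (Pi.single a 1), fun v => ?_⟩
    have h1 : l v = φ (E.H.mulVec v) := by rw [← hφ]; rfl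
    have h2 : l v = v p - v q := rfl
    rw [← h2, h1, LinearMap.pi_apply_eq_sum_univ φ]
    simp only [dotProduct, smul_eq_mul]
    refine Finset.sum_congr rfl fun a _ => ?_
    rw [mul_comm]
    congr 2
    ext b
    simp [Pi.single_apply, eq_comm]
  choose g hg using key
  let G : D.V₀ → D.V₀ → K → ℝ := fun p q => Function.extend Subtype.val (g p q) 0
  refine ⟨∑ p, ∑ q, E.form 0 (G p q) (G p q), Finset.sum_nonneg fun p _ =>
    Finset.sum_nonneg fun q _ => E.form_self_nonneg 0 _, fun u p hp q hq => ?_⟩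
  have h1 : u p - u q = -E.form 0 (G ⟨p, hp⟩ ⟨q, hq⟩) u := by
    have h2 : (fun a : D.V₀ => G ⟨p, hp⟩ ⟨q, hq⟩ a) = g ⟨p, hp⟩ ⟨q, hq⟩ :=
      funext fun a => Subtype.val_injective.extend_apply _ _ a
    rw [form_zero, neg_neg, h2, ← hg]
  rw [h1, neg_sq]
  refine (E.form_sq_le 0 _ u).trans (mul_le_mul_of_nonneg_right ?_ (E.form_self_nonneg 0 u))
  refine le_trans ?_ (Finset.single_le_sum (f := fun p => ∑ q, E.form 0 (G p q) (G p q))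
    (fun p _ => Finset.sum_nonneg fun q _ => E.form_self_nonneg 0 _)
    (Finset.mem_univ (⟨p, hp⟩ : D.V₀)))
  exact Finset.single_le_sum (f := fun q => E.form 0 (G ⟨p, hp⟩ q) (G ⟨p, hp⟩ q))
    (fun q _ => E.form_self_nonneg 0 _) (Finset.mem_univ (⟨q, hq⟩ : D.V₀))

/-- A function on `K` is harmonic from level `0` to level `1` if it is orthogonal in the level-`1`
energy to all functions that vanish on `V₀`. -/
def HarmonicOne (u : K → ℝ) : Prop :=
  ∀ φ : K → ℝ, (∀ p ∈ D.V₀, φ p = 0) → E.form 1 u φ = 0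

variable {E}

theorem HarmonicOne.congr {u u' : K → ℝ} (hu : E.HarmonicOne u) (h : EqOn u u' (D.V 1)) :
    E.HarmonicOne u' := fun φ hφ => by
  rw [← hu φ hφ]
  exact E.form_congr h.symm fun _ _ => rfl

theorem HarmonicOne.add {u v : K → ℝ} (hu : E.HarmonicOne u) (hv : E.HarmonicOne v) :
    E.HarmonicOne (u + v) := fun φ hφ => by
  rw [map_add, LinearMap.add_apply, hu φ hφ, hv φ hφ, add_zero]

theorem HarmonicOne.smul {u : K → ℝ} (hu : E.HarmonicOne u) (c : ℝ) :
    E.HarmonicOne (c • u) := fun φ hφ => by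
  rw [map_smul, LinearMap.smul_apply, hu φ hφ, smul_zero]

/-- The positive and negative parts interact non-positively, since the off-diagonal entries of the
discrete Laplacian are nonnegative. -/
theorem form_posPart_negPart_nonpos (n : ℕ) (u : K → ℝ) :
    E.form n (fun x => max (u x) 0) (fun x => max (-u x) 0) ≤ 0 := by
  induction n generalizing u with
  | zero =>
    rw [form_zero, neg_nonpos]
    simp only [dotProduct, Matrix.mulVec, Finset.mul_sum]
    refine Finset.sum_nonneg fun p _ => Finset.sum_nonneg fun q _ => ?_
    by_cases hpq : p = q
    · subst hpq
      have : max (u p) 0 * max (-u p) 0 = 0 := by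
        rcases le_total (u p) 0 with h | h
        · rw [max_eq_right h, zero_mul]
        · rw [max_eq_right (neg_nonpos.2 h), mul_zero]
      rw [mul_left_comm, this, mul_zero]
    · exact mul_nonneg (le_max_right _ _)
        (mul_nonneg (E.isLaplacian.offDiag_nonneg p q hpq) (le_max_right _ _))
  | succ n ih =>
    rw [form_succ]
    exact Finset.sum_nonpos fun i _ =>
      mul_nonpos_of_nonneg_of_nonpos (inv_nonneg.2 (E.r_pos i).le) (ih (u ∘ D.F i))

variable (E)

theorem form_zero_le_form_one (u : K → ℝ) : E.form 0 u u ≤ E.form 1 u u := by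
  rw [form_zero]
  exact (E.harmonic fun p => u p).2 ⟨u, fun p => rfl, (E.levelEnergy_eq_form 1 u).symm⟩

theorem harmonicOne_of_form_eq {u : K → ℝ} (h : E.form 1 u u = E.form 0 u u) :
    E.HarmonicOne u := by
  intro φ hφ
  have key : ∀ t : ℝ, 0 ≤ E.form 1 φ φ * (t * t) + (2 * E.form 1 u φ) * t + 0 := by
    intro t
    have h1 := E.form_zero_le_form_one (u + t • φ)
    have h2 : E.form 0 (u + t • φ) (u + t • φ) = E.form 0 u u := by
      have : EqOn (u + t • φ) u (D.V 0) := fun p hp => by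
        rw [SelfSimilarSet.V_zero] at hp
        simp [hφ p hp]
      exact E.form_congr this this
    rw [h2, ← h] at h1
    simp only [map_add, LinearMap.add_apply, map_smul, LinearMap.smul_apply, smul_eq_mul] at h1
    rw [E.form_comm 1 φ u] at h1
    linarith
  have := discrim_le_zero key
  rw [discrim] at this
  nlinarith [sq_nonneg (E.form 1 u φ)]

theorem harmonicOne_const (c : ℝ) : E.HarmonicOne fun _ => c := by
  have hz : ∀ n, E.form n (fun _ => c) (fun _ => c) = 0 := by
    intro n
    induction n with
    | zero =>
      rw [form_zero, (E.isLaplacian.ker _).2 ⟨c, fun _ => rfl⟩, dotProduct_zero, neg_zero]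
    | succ n ih =>
      rw [form_succ]
      exact Finset.sum_eq_zero fun i _ => mul_eq_zero_of_right _ ih
  exact E.harmonicOne_of_form_eq (by rw [hz, hz])

/-- The discrete Dirichlet problem from `V₀` to `V₁` is solvable. -/
theorem exists_harmonicOne (g : K → ℝ) :
    ∃ u : K → ℝ, E.HarmonicOne u ∧ (∀ p ∈ D.V₀, u p = g p) ∧ E.form 1 u u = E.form 0 u u := by
  obtain ⟨u, hu, he⟩ := (E.harmonic fun p => g p).1
  have h0 : (fun p : D.V₀ => g p) = fun p : D.V₀ => u p := funext fun p => (hu p).symm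
  rw [levelEnergy_eq_form, h0, ← form_zero] at he
  exact ⟨u, E.harmonicOne_of_form_eq he.symm, fun p hp => hu ⟨p, hp⟩, he.symm⟩

variable [ConnectedSpace K]

/-- Connectedness of `K`: a function of zero level-`1` energy that vanishes on `V₀` vanishes on
`V₁`. -/
theorem eq_zero_of_form_one_eq_zero {φ : K → ℝ} (h : E.form 1 φ φ = 0) (hφ : ∀ p ∈ D.V₀, φ p = 0) :
    ∀ p ∈ D.V 1, φ p = 0 := by
  have hterm : ∀ i, E.form 0 (φ ∘ D.F i) (φ ∘ D.F i) = 0 := by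
    rw [form_succ, Finset.sum_eq_zero_iff_of_nonneg fun i _ =>
      mul_nonneg (inv_nonneg.2 (E.r_pos i).le) (E.form_self_nonneg 0 _)] at h
    intro i
    exact (mul_eq_zero.1 (h i (Finset.mem_univ i))).resolve_left (inv_ne_zero (E.r_pos i).ne')
  have hall := D.mem_of_overlap_closed {i | ∀ q ∈ D.V₀, φ (D.F i q) = 0} ?_ ?_
  · intro p hp
    obtain ⟨i, q, hq, rfl⟩ := D.exists_of_mem_V_succ hp
    rw [SelfSimilarSet.V_zero] at hq
    exact hall i q hq
  · obtain ⟨p, hp⟩ := D.V₀_nonempty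
    obtain ⟨i, q, hq, rfl⟩ := D.exists_F_eq_of_mem_V₀ hp
    exact ⟨i, fun q' hq' => (E.eq_of_form_zero_eq_zero (hterm i) hq' hq).trans (hφ _ hp)⟩
  · intro i hi j x y e q hq
    by_cases hij : i = j
    · exact hij ▸ hi q (hq)
    · have hx := D.mem_V₀_of_overlap hij e
      have hy := D.mem_V₀_of_overlap (Ne.symm hij) e.symm
      refine (E.eq_of_form_zero_eq_zero (hterm j) hq hy).trans ?_
      show φ (D.F j y) = 0
      rw [← e]
      exact hi x hx

variable {E}

theorem HarmonicOne.eq_zero {u : K → ℝ} (hu : E.HarmonicOne u) (h : ∀ p ∈ D.V₀, u p = 0) :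
    ∀ p ∈ D.V 1, u p = 0 :=
  E.eq_zero_of_form_one_eq_zero (hu u h) h

theorem HarmonicOne.eqOn {u v : K → ℝ} (hu : E.HarmonicOne u) (hv : E.HarmonicOne v)
    (h : ∀ p ∈ D.V₀, u p = v p) : EqOn u v (D.V 1) := fun p hp => by
  have := (hu.add (hv.smul (-1))).eq_zero (fun p hp => by simp [h p hp]) p hp
  simp at this
  linarith

theorem HarmonicOne.form_self {u : K → ℝ} (hu : E.HarmonicOne u) :
    E.form 1 u u = E.form 0 u u := by
  obtain ⟨w, hw, hb, he⟩ := E.exists_harmonicOne u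
  have h1 : EqOn w u (D.V 1) := hw.eqOn hu hb
  have h0 : EqOn w u (D.V 0) := h1.mono (D.V_mono zero_le_one)
  rw [E.form_congr h1 h1, E.form_congr h0 h0] at he
  exact he

theorem HarmonicOne.form_eq {u : K → ℝ} (hu : E.HarmonicOne u) (g : K → ℝ) :
    E.form 1 u g = E.form 0 u g := by
  obtain ⟨w, hw, hb, he⟩ := E.exists_harmonicOne g
  have h1 : E.form 1 u g = E.form 1 u w := by
    have := hu (g - w) fun p hp => by simp [hb p hp]
    rw [map_sub] at this
    linarith
  have h0 : E.form 0 u g = E.form 0 u w :=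
    E.form_congr (fun _ _ => rfl) fun p hp => (hb p (by rwa [SelfSimilarSet.V_zero] at hp)).symm
  have h2 := (hu.add hw).form_self
  simp only [map_add, LinearMap.add_apply] at h2
  rw [E.form_comm 1 w u, E.form_comm 0 w u, hu.form_self, hw.form_self] at h2
  rw [h1, h0]
  linarith

/-- The maximum principle, in the form of positivity preservation. -/
theorem HarmonicOne.nonneg {u : K → ℝ} (hu : E.HarmonicOne u) (h : ∀ p ∈ D.V₀, 0 ≤ u p) :
    ∀ p ∈ D.V 1, 0 ≤ u p := by
  set a : K → ℝ := fun x => max (u x) 0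
  set b : K → ℝ := fun x => max (-u x) 0
  have hb0 : ∀ p ∈ D.V₀, b p = 0 := fun p hp => max_eq_right (neg_nonpos.2 (h p hp))
  have hab : u = a - b := by
    ext x
    simp only [a, b, Pi.sub_apply]
    rcases le_total (u x) 0 with h | h
    · rw [max_eq_right h, max_eq_left (neg_nonneg.2 h)]; ring
    · rw [max_eq_left h, max_eq_right (neg_nonpos.2 h)]; ring
  have h1 := hu b hb0
  rw [hab, map_sub, LinearMap.sub_apply] at h1
  have h2 : E.form 1 a b ≤ 0 := form_posPart_negPart_nonpos 1 u
  have h3 : E.form 1 b b = 0 := le_antisymm (by linarith) (E.form_self_nonneg 1 b)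
  intro p hp
  have := E.eq_zero_of_form_one_eq_zero h3 hb0 p hp
  have : max (-u p) 0 = 0 := this
  linarith [max_eq_right_iff.1 this]

theorem HarmonicOne.mem_Icc {u : K → ℝ} (hu : E.HarmonicOne u) {a b : ℝ}
    (h : ∀ p ∈ D.V₀, u p ∈ Icc a b) : ∀ p ∈ D.V 1, u p ∈ Icc a b := by
  intro p hp
  have h1 := (hu.add (E.harmonicOne_const (-a))).nonneg (fun p hp => by
    have := (h p hp).1
    simp only [Pi.add_apply]; linarith) p hp
  have h2 := ((hu.smul (-1)).add (E.harmonicOne_const b)).nonneg (fun p hp => by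
    have := (h p hp).2
    simp only [Pi.add_apply, Pi.smul_apply, smul_eq_mul]; linarith) p hp
  simp only [Pi.add_apply, Pi.smul_apply, smul_eq_mul] at h1 h2
  exact ⟨by linarith, by linarith⟩

end RegularHarmonicStructure

/-! ### Piecewise harmonic functions: uniqueness, positivity and existence -/

namespace RegularHarmonicStructure

variable {s : ℕ} {K : Type*} [MetricSpace K] [CompactSpace K] [Nonempty K] {D : PCFSet s K}
  (E : RegularHarmonicStructure D)

/-- `u` is harmonic from level `n` to level `n + 1`: on every cell of level `n` its values on the
vertices of level `n + 1` solve the discrete Dirichlet problem. -/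
def HarmonicStep : ℕ → (K → ℝ) → Prop
  | 0, u => E.HarmonicOne u
  | n + 1, u => ∀ i, HarmonicStep n (u ∘ D.F i)

/-- `u` is harmonic outside `V_m`. -/
def PiecewiseHarmonic (m : ℕ) (u : K → ℝ) : Prop := ∀ n, m ≤ n → E.HarmonicStep n u

variable {E}

theorem HarmonicStep.add {n : ℕ} {u v : K → ℝ} (hu : E.HarmonicStep n u)
    (hv : E.HarmonicStep n v) : E.HarmonicStep n (u + v) := by
  induction n generalizing u v with
  | zero => exact HarmonicOne.add hu hv
  | succ n ih => exact fun i => ih (hu i) (hv i)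

theorem HarmonicStep.smul {n : ℕ} {u : K → ℝ} (hu : E.HarmonicStep n u) (c : ℝ) :
    E.HarmonicStep n (c • u) := by
  induction n generalizing u with
  | zero => exact HarmonicOne.smul hu c
  | succ n ih => exact fun i => ih (hu i)

theorem PiecewiseHarmonic.add {m : ℕ} {u v : K → ℝ} (hu : E.PiecewiseHarmonic m u)
    (hv : E.PiecewiseHarmonic m v) : E.PiecewiseHarmonic m (u + v) :=
  fun n hn => (hu n hn).add (hv n hn)

theorem PiecewiseHarmonic.smul {m : ℕ} {u : K → ℝ} (hu : E.PiecewiseHarmonic m u) (c : ℝ) :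
    E.PiecewiseHarmonic m (c • u) :=
  fun n hn => (hu n hn).smul c

theorem PiecewiseHarmonic.mono {m n : ℕ} {u : K → ℝ} (hu : E.PiecewiseHarmonic m u)
    (h : m ≤ n) : E.PiecewiseHarmonic n u := fun k hk => hu k (h.trans hk)

theorem PiecewiseHarmonic.comp_F {m : ℕ} {u : K → ℝ} (hu : E.PiecewiseHarmonic (m + 1) u)
    (i : Fin s) : E.PiecewiseHarmonic m (u ∘ D.F i) := fun n hn => hu (n + 1) (by omega) i

theorem piecewiseHarmonic_succ {m : ℕ} {u : K → ℝ}
    (hu : ∀ i, E.PiecewiseHarmonic m (u ∘ D.F i)) : E.PiecewiseHarmonic (m + 1) u := by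
  rintro (_ | n) hn
  · omega
  · exact fun i => hu i n (by omega)

theorem piecewiseHarmonic_zero (m : ℕ) : E.PiecewiseHarmonic m (0 : K → ℝ) := by
  have h : ∀ n, E.HarmonicStep n (0 : K → ℝ) := by
    intro n
    induction n with
    | zero => exact E.harmonicOne_const 0
    | succ n ih => exact fun i => ih
  exact fun n _ => h n

theorem PiecewiseHarmonic.sum {ι : Type*} (S : Finset ι) {m : ℕ} {f : ι → K → ℝ}
    (hf : ∀ a ∈ S, E.PiecewiseHarmonic m (f a)) : E.PiecewiseHarmonic m (∑ a ∈ S, f a) := by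
  classical
  induction S using Finset.induction_on with
  | empty => exact piecewiseHarmonic_zero m
  | insert a S ha ih =>
    rw [Finset.sum_insert ha]
    exact (hf a (Finset.mem_insert_self a S)).add
      (ih fun b hb => hf b (Finset.mem_insert_of_mem hb))

theorem form_le_form_succ (n : ℕ) (u : K → ℝ) : E.form n u u ≤ E.form (n + 1) u u := by
  induction n generalizing u with
  | zero => exact E.form_zero_le_form_one u
  | succ n ih =>
    rw [form_succ, form_succ]
    exact Finset.sum_le_sum fun i _ =>
      mul_le_mul_of_nonneg_left (ih _) (inv_nonneg.2 (E.r_pos i).le)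

theorem form_self_mono (u : K → ℝ) : Monotone fun n => E.form n u u :=
  monotone_nat_of_le_succ fun n => form_le_form_succ n u

theorem harmonicStep_of_form_eq {n : ℕ} {u : K → ℝ} (h : E.form (n + 1) u u = E.form n u u) :
    E.HarmonicStep n u := by
  induction n generalizing u with
  | zero => exact E.harmonicOne_of_form_eq h
  | succ n ih =>
    intro i
    apply ih
    rw [E.form_succ (n + 1), E.form_succ n] at h
    have := (Finset.sum_eq_sum_iff_of_le fun i _ => mul_le_mul_of_nonneg_left
      (form_le_form_succ n (u ∘ D.F i)) (inv_nonneg.2 (E.r_pos i).le)).1 h.symm i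
      (Finset.mem_univ i)
    exact (mul_left_cancel₀ (inv_ne_zero (E.r_pos i).ne') this).symm

variable (E)

/-- A solution of the discrete Dirichlet problem on `V₁` with boundary values `g`. -/
noncomputable def stepExt (g : K → ℝ) : K → ℝ := (E.exists_harmonicOne g).choose

theorem stepExt_harmonicOne (g : K → ℝ) : E.HarmonicOne (E.stepExt g) :=
  (E.exists_harmonicOne g).choose_spec.1

theorem stepExt_eq (g : K → ℝ) {p : K} (hp : p ∈ D.V₀) : E.stepExt g p = g p :=
  (E.exists_harmonicOne g).choose_spec.2.1 p hp

variable {E}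

section Connected

variable [ConnectedSpace K]

theorem HarmonicStep.form_eq {n : ℕ} {u : K → ℝ} (hu : E.HarmonicStep n u) (g : K → ℝ) :
    E.form (n + 1) u g = E.form n u g := by
  induction n generalizing u g with
  | zero => exact HarmonicOne.form_eq hu g
  | succ n ih =>
    rw [E.form_succ (n + 1), E.form_succ n]
    exact Finset.sum_congr rfl fun i _ => by rw [ih (hu i)]

theorem HarmonicStep.nonneg {n : ℕ} {u : K → ℝ} (hu : E.HarmonicStep n u)
    (h : ∀ p ∈ D.V n, 0 ≤ u p) : ∀ p ∈ D.V (n + 1), 0 ≤ u p := by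
  induction n generalizing u with
  | zero => exact HarmonicOne.nonneg hu fun p hp => h p (by rwa [SelfSimilarSet.V_zero])
  | succ n ih =>
    intro p hp
    obtain ⟨i, q, hq, rfl⟩ := D.exists_of_mem_V_succ hp
    exact ih (hu i) (fun x hx => h _ (D.F_mem_V_succ i hx)) q hq

/-- The energy pairing with a function that is harmonic outside `V_m` only sees level `m`. -/
theorem PiecewiseHarmonic.form_eq {m n : ℕ} (hmn : m ≤ n) {u : K → ℝ}
    (hu : E.PiecewiseHarmonic m u) (g : K → ℝ) : E.form n u g = E.form m u g := by
  induction n, hmn using Nat.le_induction with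
  | base => rfl
  | succ n hn ih => rw [(hu n hn).form_eq, ih]

theorem PiecewiseHarmonic.nonneg {m : ℕ} {u : C(K, ℝ)} (hu : E.PiecewiseHarmonic m u)
    (h : ∀ p ∈ D.V m, 0 ≤ u p) (x : K) : 0 ≤ u x := by
  refine D.mem_of_isClosed (Z := {x | 0 ≤ u x}) (isClosed_le continuous_const u.continuous)
    (m := m) (fun n hn => ?_) x
  induction n, hn using Nat.le_induction with
  | base => exact h
  | succ n hn ih => exact (hu n hn).nonneg ih

/-- A continuous function that is harmonic outside `V_m` is determined by its values on `V_m`. -/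
theorem PiecewiseHarmonic.eq {m : ℕ} {u v : C(K, ℝ)} (hu : E.PiecewiseHarmonic m u)
    (hv : E.PiecewiseHarmonic m v) (h : EqOn u v (D.V m)) : u = v := by
  have key : ∀ u v : C(K, ℝ), E.PiecewiseHarmonic m u → E.PiecewiseHarmonic m v →
      EqOn u v (D.V m) → ∀ x, u x ≤ v x := by
    intro u v hu hv h x
    have h1 : E.PiecewiseHarmonic m (v + (-1 : ℝ) • u : C(K, ℝ)) := hv.add (hu.smul (-1))
    have h2 := h1.nonneg (fun p hp => by simp [h hp]) x
    simp at h2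
    linarith
  ext x
  exact le_antisymm (key u v hu hv h x) (key v u hv hu h.symm x)

/-! #### Existence of the harmonic extension -/

/-- A continuous extension of boundary values that stays between their extremes. -/
theorem exists_continuous_extension (g : K → ℝ) :
    ∃ f : C(K, ℝ), (∀ p ∈ D.V₀, f p = g p) ∧
      ∃ p ∈ D.V₀, ∃ q ∈ D.V₀, (∀ x, f x ∈ Icc (g p) (g q)) ∧ ∀ x ∈ D.V₀, g x ∈ Icc (g p) (g q) := by
  have hfin : D.V₀.Finite := D.finite_postCritical.image _
  obtain ⟨p, hp, hpm⟩ := hfin.exists_minimalFor g _ D.V₀_nonempty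
  obtain ⟨q, hq, hqm⟩ := hfin.exists_maximalFor g _ D.V₀_nonempty
  have hb : ∀ x ∈ D.V₀, g x ∈ Icc (g p) (g q) := fun x hx =>
    ⟨(le_total (g p) (g x)).elim id fun h => hpm hx h,
      (le_total (g x) (g q)).elim id fun h => hqm hx h⟩
  have : Nonempty D.V₀ := ⟨⟨p, hp⟩⟩
  let g₀ : C(D.V₀, ℝ) := ⟨fun x => g x, continuous_of_discreteTopology⟩
  obtain ⟨f, hf, hfg⟩ := g₀.exists_extension_forall_mem_of_isClosedEmbedding
    (t := Icc (g p) (g q)) (fun x => hb x x.2) ⟨_, hb p hp⟩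
    hfin.isClosed.isClosedEmbedding_subtypeVal
  exact ⟨f, fun x hx => congrFun hfg ⟨x, hx⟩, p, hp, q, hq, hf, hb⟩

variable (E)

/-- Approximations of the harmonic extension of `g`: the values on `V_n` are those of the harmonic
extension, and they are interpolated continuously on the cells of level `n`. -/
noncomputable def approx : ℕ → (K → ℝ) → C(K, ℝ)
  | 0, g => (exists_continuous_extension (D := D) g).choose
  | n + 1, g => D.glue fun i => approx n (E.stepExt g ∘ D.F i)

theorem approx_compatible {n : ℕ} (h : ∀ g, ∀ p ∈ D.V₀, E.approx n g p = g p) (g : K → ℝ)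
    (i j : Fin s) (x y : K) (e : D.F i x = D.F j y) :
    E.approx n (E.stepExt g ∘ D.F i) x = E.approx n (E.stepExt g ∘ D.F j) y := by
  refine D.compatible_of_boundary (v := fun i => E.approx n (E.stepExt g ∘ D.F i))
    (fun i j x hx y hy e => ?_) i j x y e
  simp only [h _ x hx, h _ y hy, Function.comp_apply, e]

theorem approx_boundary (n : ℕ) (g : K → ℝ) : ∀ p ∈ D.V₀, E.approx n g p = g p := by
  induction n generalizing g with
  | zero => exact (exists_continuous_extension (D := D) g).choose_spec.1
  | succ n ih =>
    intro p hp
    obtain ⟨i, q, hq, rfl⟩ := D.exists_F_eq_of_mem_V₀ hp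
    rw [approx, D.glue_apply (E.approx_compatible ih g), ih _ q hq]
    exact E.stepExt_eq g hp

theorem approx_succ_apply (n : ℕ) (g : K → ℝ) (i : Fin s) (x : K) :
    E.approx (n + 1) g (D.F i x) = E.approx n (E.stepExt g ∘ D.F i) x := by
  rw [approx, D.glue_apply (E.approx_compatible (E.approx_boundary n) g)]

theorem approx_zero_mem {g : K → ℝ} {a b : ℝ} (h : ∀ p ∈ D.V₀, g p ∈ Icc a b) (x : K) :
    E.approx 0 g x ∈ Icc a b := by
  obtain ⟨p, hp, q, hq, hf, -⟩ := (exists_continuous_extension (D := D) g).choose_spec.2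
  exact ⟨(h p hp).1.trans (hf x).1, (hf x).2.trans (h q hq).2⟩

theorem exists_approx_bound : ∃ C ρ : ℝ, ρ < 1 ∧ ∀ n g,
    dist (E.approx n g) (E.approx (n + 1) g) ≤ √(C * E.form 0 g g) * ρ ^ n := by
  obtain ⟨C, hC0, hC⟩ := E.exists_resistance_bound
  have hs := D.two_le
  have : Nonempty (Fin s) := ⟨⟨0, by omega⟩⟩
  obtain ⟨j, hj⟩ := Finite.exists_max E.r
  refine ⟨C, √(E.r j), (Real.sqrt_lt' one_pos).2 (by simpa using E.r_lt_one j), fun n => ?_⟩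
  induction n with
  | zero =>
    intro g
    obtain ⟨p, hp, q, hq, -, hb⟩ := (exists_continuous_extension (D := D) g).choose_spec.2
    have hpq : g q - g p ≤ √(C * E.form 0 g g) := Real.le_sqrt_of_sq_le (hC g q hq p hp)
    rw [pow_zero, mul_one, ContinuousMap.dist_le (Real.sqrt_nonneg _)]
    intro x
    refine le_trans ?_ hpq
    obtain ⟨i, y, rfl⟩ := D.exists_eq_F x
    have h1 := E.approx_zero_mem hb (D.F i y)
    have h2 : E.approx (0 + 1) g (D.F i y) ∈ Icc (g p) (g q) := by
      rw [approx_succ_apply]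
      refine E.approx_zero_mem (fun z hz => ?_) y
      refine (E.stepExt_harmonicOne g).mem_Icc (fun p hp => ?_) _
        (D.F_mem_V_succ i (by rwa [SelfSimilarSet.V_zero]))
      rw [E.stepExt_eq g hp]
      exact hb p hp
    exact Real.dist_le_of_mem_Icc h1 h2
  | succ n ih =>
    intro g
    rw [ContinuousMap.dist_le (by positivity)]
    intro x
    obtain ⟨i, y, rfl⟩ := D.exists_eq_F x
    rw [approx_succ_apply, approx_succ_apply]
    refine (ContinuousMap.dist_apply_le_dist y).trans ((ih _).trans ?_)
    rw [pow_succ', ← mul_assoc]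
    refine mul_le_mul_of_nonneg_right ?_ (by positivity)
    rw [← Real.sqrt_mul (mul_nonneg hC0 (E.form_self_nonneg 0 g))]
    apply Real.sqrt_le_sqrt
    rw [mul_assoc]
    refine mul_le_mul_of_nonneg_left ?_ hC0
    -- The energy on the cell `i` is at most `r i` times the total energy.
    have h1 : E.form 1 (E.stepExt g) (E.stepExt g) = E.form 0 g g := by
      have h0 : EqOn (E.stepExt g) g (D.V 0) := fun p hp =>
        E.stepExt_eq g (by rwa [SelfSimilarSet.V_zero] at hp)
      rw [(E.stepExt_harmonicOne g).form_self, E.form_congr h0 h0]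
    have h2 : (E.r i)⁻¹ * E.form 0 (E.stepExt g ∘ D.F i) (E.stepExt g ∘ D.F i) ≤
        E.form 0 g g := by
      rw [← h1, form_succ]
      exact Finset.single_le_sum
        (f := fun i => (E.r i)⁻¹ * E.form 0 (E.stepExt g ∘ D.F i) (E.stepExt g ∘ D.F i))
        (fun i _ => mul_nonneg (inv_nonneg.2 (E.r_pos i).le) (E.form_self_nonneg 0 _))
        (Finset.mem_univ i)
    rw [inv_mul_le_iff₀ (E.r_pos i)] at h2
    calc _ ≤ E.r i * E.form 0 g g := h2
      _ ≤ E.form 0 g g * E.r j := by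
        rw [mul_comm]
        exact mul_le_mul_of_nonneg_left (hj i) (E.form_self_nonneg 0 g)

theorem exists_harmonic_extension (g : K → ℝ) :
    ∃ u : C(K, ℝ), E.PiecewiseHarmonic 0 u ∧ ∀ p ∈ D.V₀, u p = g p := by
  obtain ⟨C, ρ, hρ, hb⟩ := E.exists_approx_bound
  have hlim : ∀ g, ∃ u : C(K, ℝ), Tendsto (fun n => E.approx n g) atTop (𝓝 u) := fun g =>
    cauchySeq_tendsto_of_complete (cauchySeq_of_le_geometric ρ _ hρ fun n => hb n g)
  choose h hh using hlim
  have hpt : ∀ g x, Tendsto (fun n => E.approx n g x) atTop (𝓝 (h g x)) := fun g x =>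
    ((continuous_eval_const x).tendsto (h g)).comp (hh g)
  have hV₀ : ∀ g, ∀ p ∈ D.V₀, h g p = g p := fun g p hp =>
    tendsto_nhds_unique (hpt g p) (tendsto_const_nhds.congr
      fun n => (E.approx_boundary n g p hp).symm)
  have hF : ∀ g i x, h g (D.F i x) = h (E.stepExt g ∘ D.F i) x := fun g i x =>
    tendsto_nhds_unique ((hpt g (D.F i x)).comp (tendsto_add_atTop_nat 1))
      ((hpt (E.stepExt g ∘ D.F i) x).congr fun n => (E.approx_succ_apply n g i x).symm)
  refine ⟨h g, fun n _ => ?_, hV₀ g⟩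
  induction n generalizing g with
  | zero =>
    refine (E.stepExt_harmonicOne g).congr fun x hx => ?_
    obtain ⟨i, q, hq, rfl⟩ := D.exists_of_mem_V_succ hx
    rw [SelfSimilarSet.V_zero] at hq
    rw [hF, hV₀ _ q hq]
    rfl
  | succ n ih =>
    intro i
    have : h g ∘ D.F i = h (E.stepExt g ∘ D.F i) := funext fun x => hF g i x
    rw [this]
    exact ih _ n.zero_le

theorem exists_piecewiseHarmonic (m : ℕ) (g : K → ℝ) :
    ∃ u : C(K, ℝ), E.PiecewiseHarmonic m u ∧ EqOn u g (D.V m) := by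
  induction m generalizing g with
  | zero =>
    rw [SelfSimilarSet.V_zero]
    exact E.exists_harmonic_extension g
  | succ m ih =>
    choose v hv hvg using fun i => ih (g ∘ D.F i)
    have hcomp := D.compatible_of_boundary (v := v) fun i j x hx y hy e => by
      rw [hvg i (D.V₀_subset_V m hx), hvg j (D.V₀_subset_V m hy)]
      simp only [Function.comp_apply, e]
    refine ⟨D.glue v, piecewiseHarmonic_succ fun i => ?_, fun x hx => ?_⟩
    · have : D.glue v ∘ D.F i = v i := funext fun x => D.glue_apply hcomp i x
      rw [this]
      exact hv i
    · obtain ⟨i, y, hy, rfl⟩ := D.exists_of_mem_V_succ hx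
      rw [D.glue_apply hcomp, hvg i hy]
      rfl

end Connected

end RegularHarmonicStructure

/-! ### The self-similar measure -/

namespace SelfSimilarSet

variable {s : ℕ} {K : Type*} [MetricSpace K] {D : SelfSimilarSet s K} {M : ProbWeights s}
  [MeasurableSpace K] [BorelSpace K] {μ : Measure K}

theorem IsSelfSimilarMeasure.integral_eq [CompactSpace K] (hμ : D.IsSelfSimilarMeasure M μ)
    (g : C(K, ℝ)) : ∫ x, g x ∂μ = ∑ i, M.wt i * ∫ x, g (D.F i x) ∂μ := by
  have := hμ.1
  have hm : ∀ i, Measurable (D.F i) := fun i => (D.continuous_F i).measurable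
  have hint : ∀ i, Integrable g (μ.map (D.F i)) := fun i => by
    have := Measure.isProbabilityMeasure_map (μ := μ) (hm i).aemeasurable
    exact g.continuous.integrable_of_hasCompactSupport (HasCompactSupport.of_compactSpace g)
  calc ∫ x, g x ∂μ = ∫ x, g x ∂(∑ i, ENNReal.ofReal (M.wt i) • μ.map (D.F i)) := by rw [← hμ.2]
    _ = ∑ i, ∫ x, g x ∂(ENNReal.ofReal (M.wt i) • μ.map (D.F i)) :=
      integral_finsetSum_measure fun i _ => (hint i).smul_measure ENNReal.ofReal_ne_top
    _ = ∑ i, M.wt i * ∫ x, g (D.F i x) ∂μ := by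
      refine Finset.sum_congr rfl fun i _ => ?_
      rw [integral_smul_measure, ENNReal.toReal_ofReal (M.pos i).le, smul_eq_mul,
        integral_map (hm i).aemeasurable g.continuous.aestronglyMeasurable]

theorem IsSelfSimilarMeasure.isOpenPosMeasure [CompactSpace K]
    (hμ : D.IsSelfSimilarMeasure M μ) : μ.IsOpenPosMeasure := by
  obtain ⟨c, hc1, hc⟩ := D.exists_ratio
  have := hμ.1
  have key : ∀ (n : ℕ) (x : K),
      0 < μ (Metric.closedBall x ((c : ℝ) ^ n * Metric.diam (univ : Set K))) := by
    intro n
    induction n with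
    | zero =>
      intro x
      have : Metric.closedBall x ((c : ℝ) ^ 0 * Metric.diam (univ : Set K)) = univ :=
        eq_univ_of_forall fun y => by simpa using dist_le_diam_univ y x
      rw [this, measure_univ]
      exact one_pos
    | succ n ih =>
      intro x
      obtain ⟨i, y, rfl⟩ := D.exists_eq_F x
      set S := Metric.closedBall (D.F i y) ((c : ℝ) ^ (n + 1) * Metric.diam (univ : Set K))
      have h1 : ENNReal.ofReal (M.wt i) * μ (D.F i ⁻¹' S) ≤ μ S := by
        conv_rhs => rw [hμ.2]
        rw [Measure.finsetSum_apply]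
        refine le_trans ?_ (Finset.single_le_sum
          (f := fun i => (ENNReal.ofReal (M.wt i) • μ.map (D.F i)) S)
          (fun _ _ => zero_le) (Finset.mem_univ i))
        rw [Measure.smul_apply, smul_eq_mul,
          Measure.map_apply (D.continuous_F i).measurable Metric.isClosed_closedBall.measurableSet]
      have h2 : 0 < μ (D.F i ⁻¹' S) :=
        (ih y).trans_le (measure_mono fun z hz => D.dist_F_le hc i n hz)
      exact (ENNReal.mul_pos (by simpa using M.pos i) h2.ne').trans_le h1
  refine ⟨fun U hU ⟨x, hx⟩ => ?_⟩
  obtain ⟨ε, hε, hball⟩ := Metric.isOpen_iff.1 hU x hx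
  obtain ⟨n, hn⟩ := ((tendsto_ratio_pow_mul_diam (K := K) hc1).eventually (gt_mem_nhds hε)).exists
  exact ((key n x).trans_le
    (measure_mono ((Metric.closedBall_subset_ball hn).trans hball))).ne'

end SelfSimilarSet

/-! ### Tent functions and the discrete Laplacians -/

namespace RegularHarmonicStructure

variable {s : ℕ} {K : Type*} [MetricSpace K] [CompactSpace K] [Nonempty K] {D : PCFSet s K}
  (E : RegularHarmonicStructure D)

/-- Summation by parts: the operator `H_m` and the level-`m` energy form. -/
theorem sum_words_eq_neg_form (m : ℕ) (u g : K → ℝ) :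
    ∑ w : Fin m → Fin s, (∏ k, E.r (w k))⁻¹ * ∑ q : D.V₀, g (D.Fw (List.ofFn w) q) *
      E.H.mulVec (fun q' : D.V₀ => u (D.Fw (List.ofFn w) q')) q = -E.form m u g := by
  induction m generalizing u g with
  | zero =>
    rw [form_comm, form_zero, neg_neg]
    simp [SelfSimilarSet.Fw, dotProduct]
  | succ m ih =>
    rw [form_succ, ← (Fin.consEquiv fun _ => Fin s).sum_comp, Fintype.sum_prod_type,
      ← Finset.sum_neg_distrib]
    refine Finset.sum_congr rfl fun i _ => ?_
    rw [← mul_neg, ← ih, Finset.mul_sum]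
    refine Finset.sum_congr rfl fun w _ => ?_
    simp only [Fin.consEquiv_apply, Fin.prod_univ_succ, Fin.cons_zero, Fin.cons_succ,
      List.ofFn_succ, SelfSimilarSet.Fw, Function.comp_apply, mul_inv, mul_assoc]

theorem Hm_eq_neg_form (m : ℕ) (u : K → ℝ) (p : K) :
    E.Hm m u p = -E.form m u (indicator {p} 1) := by
  classical
  rw [← sum_words_eq_neg_form, Hm]
  simp only [indicator_apply, mem_singleton_iff, Pi.one_apply, ite_mul, one_mul, zero_mul]

theorem form_eq_neg_sum_Hm (n : ℕ) (u g : K → ℝ) :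
    E.form n u g = -∑ q ∈ (D.finite_V n).toFinset, g q * E.Hm n u q := by
  classical
  have h : EqOn g (∑ q ∈ (D.finite_V n).toFinset, g q • indicator {q} (1 : K → ℝ)) (D.V n) := by
    intro x hx
    simp [Finset.sum_apply, Pi.single_apply, hx]
  rw [E.form_congr (fun _ _ => rfl) h, map_sum, ← Finset.sum_neg_distrib]
  refine Finset.sum_congr rfl fun q _ => ?_
  rw [map_smul, smul_eq_mul, Hm_eq_neg_form, mul_neg, neg_neg]

theorem indicator_comp_F {i : Fin s} {p q : K} (h : D.F i q = p) :
    (indicator {p} (1 : K → ℝ)) ∘ D.F i = indicator {q} 1 := by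
  classical
  ext x
  simp [Pi.single_apply, ← h, (D.injective i).eq_iff]

theorem indicator_comp_F_eqOn_zero {i : Fin s} {p : K} {m : ℕ} (h : ∀ q ∈ D.V m, D.F i q ≠ p) :
    EqOn ((indicator {p} (1 : K → ℝ)) ∘ D.F i) 0 (D.V m) := by
  classical
  intro x hx
  simp [h x hx]

variable [ConnectedSpace K]

/-- The tent functions are the continuous functions, harmonic outside `V_m`, with value `1` at one
vertex and `0` at the others. -/
theorem tent_spec {m : ℕ} {p : K} (hp : p ∈ D.V m) :
    E.PiecewiseHarmonic m (E.tent m p) ∧ EqOn (E.tent m p) (indicator {p} 1) (D.V m) := by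
  classical
  obtain ⟨ψ, hψ, hψp⟩ := E.exists_piecewiseHarmonic m (indicator {p} 1)
  have hval : ∀ u ∈ E.tentClass m p, EqOn u (indicator {p} 1) (D.V m) := by
    intro u hu x hx
    by_cases hxp : x = p
    · rw [hxp, hu.2.1]; simp
    · rw [hu.2.2 x hx hxp]; simp [hxp]
  have hle : ∀ n, E.form n ψ ψ ≤ E.form m ψ ψ := fun n => by
    rcases le_total n m with h | h
    · exact form_self_mono _ h
    · exact (hψ.form_eq h _).le
  have hen : E.energy ψ ≤ ENNReal.ofReal (E.form m ψ ψ) := iSup_le fun n =>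
    ENNReal.ofReal_le_ofReal (by rw [levelEnergy_eq_form]; exact hle n)
  have hψc : ψ ∈ E.tentClass m p :=
    ⟨hen.trans_lt ENNReal.ofReal_lt_top, by rw [hψp hp]; simp,
      fun q hq hqp => by rw [hψp hq]; simp [hqp]⟩
  have hm : ∀ u ∈ E.tentClass m p, E.form m u u = E.form m ψ ψ := fun u hu =>
    E.form_congr ((hval u hu).trans hψp.symm) ((hval u hu).trans hψp.symm)
  have hge : ∀ (u : C(K, ℝ)) n, ENNReal.ofReal (E.form n u u) ≤ E.energy u := fun u n => by
    rw [← levelEnergy_eq_form]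
    exact le_iSup (fun n => ENNReal.ofReal (D.levelEnergy E.H E.r n u)) n
  have hmin : ∀ u ∈ E.tentClass m p, E.energy ψ ≤ E.energy u := fun u hu => by
    refine hen.trans ?_
    rw [← hm u hu]
    exact hge u m
  have hspec := Classical.epsilon_spec
    (p := fun ψ : C(K, ℝ) => ψ ∈ E.tentClass m p ∧ ∀ u ∈ E.tentClass m p, E.energy ψ ≤ E.energy u)
    ⟨ψ, hψc, hmin⟩
  change E.tent m p ∈ _ ∧ ∀ u ∈ E.tentClass m p, E.energy (E.tent m p) ≤ E.energy u at hspec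
  refine ⟨fun n hn => ?_, hval _ hspec.1⟩
  -- A minimizer has the same energy on all levels from `m` on, hence is harmonic outside `V_m`.
  have hconst : ∀ k, m ≤ k → E.form k (E.tent m p) (E.tent m p) = E.form m ψ ψ := by
    intro k hk
    apply le_antisymm
    · have := (hge (E.tent m p) k).trans ((hspec.2 ψ hψc).trans hen)
      exact (ENNReal.ofReal_le_ofReal_iff (E.form_self_nonneg m _)).1 this
    · rw [← hm _ hspec.1]
      exact form_self_mono _ hk
  exact harmonicStep_of_form_eq ((hconst (n + 1) (by omega)).trans (hconst n hn).symm)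

theorem tent_nonneg {m : ℕ} {p : K} (hp : p ∈ D.V m) (x : K) : 0 ≤ E.tent m p x :=
  (E.tent_spec hp).1.nonneg (fun q hq => by
    rw [(E.tent_spec hp).2 hq]
    exact indicator_nonneg (fun _ _ => zero_le_one) q) x

theorem tent_self {m : ℕ} {p : K} (hp : p ∈ D.V m) : E.tent m p p = 1 := by
  rw [(E.tent_spec hp).2 hp]
  simp

theorem tent_comp_F {m : ℕ} {p q : K} {i : Fin s} (hq : q ∈ D.V m) (h : D.F i q = p) (x : K) :
    E.tent (m + 1) p (D.F i x) = E.tent m q x := by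
  have hp := E.tent_spec (m := m + 1) (p := p) (h ▸ D.F_mem_V_succ i hq)
  have := PiecewiseHarmonic.eq (E := E)
    (u := (E.tent (m + 1) p).comp ⟨D.F i, D.continuous_F i⟩) (v := E.tent m q)
    (hp.1.comp_F i) (E.tent_spec hq).1 fun y hy => by
      rw [(E.tent_spec hq).2 hy, ← indicator_comp_F h]
      exact hp.2 (D.F_mem_V_succ i hy)
  exact DFunLike.congr_fun this x

theorem tent_comp_F_eq_zero {m : ℕ} {p : K} {i : Fin s} (hp : p ∈ D.V (m + 1))
    (h : ∀ q ∈ D.V m, D.F i q ≠ p) (x : K) : E.tent (m + 1) p (D.F i x) = 0 := by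
  have := PiecewiseHarmonic.eq (E := E)
    (u := (E.tent (m + 1) p).comp ⟨D.F i, D.continuous_F i⟩) (v := 0)
    ((E.tent_spec hp).1.comp_F i) (piecewiseHarmonic_zero m) fun y hy => by
      refine ((E.tent_spec hp).2 (D.F_mem_V_succ i hy)).trans ?_
      exact indicator_comp_F_eqOn_zero h hy
  exact DFunLike.congr_fun this x

/-- The tent functions are supported in the cells that meet at their vertex. -/
theorem dist_le_of_tent_ne_zero {c : ℝ≥0} (hc : ∀ i, LipschitzWith c (D.F i)) {m : ℕ} {p x : K}
    (hp : p ∈ D.V m) (h : E.tent m p x ≠ 0) :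
    dist x p ≤ (c : ℝ) ^ m * Metric.diam (univ : Set K) := by
  induction m generalizing p x with
  | zero => simpa using SelfSimilarSet.dist_le_diam_univ x p
  | succ m ih =>
    obtain ⟨i, y, rfl⟩ := D.exists_eq_F x
    by_cases hq : ∃ q ∈ D.V m, D.F i q = p
    · obtain ⟨q, hq, rfl⟩ := hq
      rw [E.tent_comp_F hq rfl] at h
      exact D.dist_F_le hc i m (ih hq h)
    · push Not at hq
      exact absurd (E.tent_comp_F_eq_zero hp hq y) h

/-- Tent functions of a finer level interpolate functions that are harmonic outside a coarser
vertex set. -/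
theorem PiecewiseHarmonic.eq_sum_tent {m n : ℕ} (hmn : m ≤ n) {u : C(K, ℝ)}
    (hu : E.PiecewiseHarmonic m u) :
    u = ∑ q ∈ (D.finite_V n).toFinset, u q • E.tent n q := by
  classical
  refine (hu.mono hmn).eq ?_ fun x hx => ?_
  · rw [ContinuousMap.coe_sum]
    exact PiecewiseHarmonic.sum _ fun q hq =>
      (E.tent_spec ((D.finite_V n).mem_toFinset.1 hq)).1.smul (u q)
  · rw [ContinuousMap.sum_apply]
    have : ∀ q ∈ (D.finite_V n).toFinset,
        (u q • E.tent n q) x = if x = q then u q else 0 := fun q hq => by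
      rw [ContinuousMap.smul_apply, (E.tent_spec ((D.finite_V n).mem_toFinset.1 hq)).2 hx]
      simp [indicator_apply]
    rw [Finset.sum_congr rfl this]
    simp [hx]

variable [MeasurableSpace K] [BorelSpace K] {M : ProbWeights s} {μ : Measure K}

theorem integral_tent_pos (hμ : D.IsSelfSimilarMeasure M μ) {m : ℕ} {p : K} (hp : p ∈ D.V m) :
    0 < ∫ x, E.tent m p x ∂μ := by
  have := hμ.1
  have := hμ.isOpenPosMeasure
  refine (E.tent m p).continuous.integral_pos_of_hasCompactSupport_nonneg_nonzero
    (HasCompactSupport.of_compactSpace _) (E.tent_nonneg hp) (x := p) ?_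
  rw [E.tent_self hp]
  exact one_ne_zero

theorem sum_tent_mul_integral [IsProbabilityMeasure μ] {m n : ℕ} (hmn : m ≤ n) {p : K}
    (hp : p ∈ D.V m) :
    ∑ q ∈ (D.finite_V n).toFinset, E.tent m p q * ∫ x, E.tent n q x ∂μ =
      ∫ x, E.tent m p x ∂μ := by
  have hint : ∀ f : C(K, ℝ), Integrable f μ := fun f =>
    f.continuous.integrable_of_hasCompactSupport (HasCompactSupport.of_compactSpace f)
  conv_rhs => rw [PiecewiseHarmonic.eq_sum_tent E hmn (E.tent_spec hp).1]
  simp only [ContinuousMap.sum_apply, ContinuousMap.smul_apply, smul_eq_mul]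
  rw [integral_finsetSum _ fun q _ => (hint _).const_mul _]
  simp only [integral_const_mul]

end RegularHarmonicStructure

/-! ### Pre-localized solutions and their gluing -/

namespace RegularHarmonicStructure

variable {s : ℕ} {K : Type*} [MetricSpace K] [CompactSpace K] [Nonempty K] {D : PCFSet s K}
  (E : RegularHarmonicStructure D)

theorem Hm_neg (m : ℕ) (u : C(K, ℝ)) (p : K) : E.Hm m (-u : C(K, ℝ)) p = -E.Hm m u p := by
  rw [Hm_eq_neg_form, Hm_eq_neg_form, ContinuousMap.coe_neg, map_neg, LinearMap.neg_apply]

theorem Hm_zero (m : ℕ) (p : K) : E.Hm m (0 : C(K, ℝ)) p = 0 := by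
  rw [Hm_eq_neg_form, ContinuousMap.coe_zero, map_zero, LinearMap.zero_apply, neg_zero]

theorem Hm_succ (m : ℕ) {u : C(K, ℝ)} {v : Fin s → C(K, ℝ)} (huv : ∀ i x, u (D.F i x) = v i x)
    (p : K) : E.Hm (m + 1) u p =
      ∑ i, (E.r i)⁻¹ * -E.form m (v i) (indicator {p} (1 : K → ℝ) ∘ D.F i) := by
  rw [Hm_eq_neg_form, form_succ, ← Finset.sum_neg_distrib]
  refine Finset.sum_congr rfl fun i _ => ?_
  have : u ∘ D.F i = v i := funext (huv i)
  rw [this, mul_neg]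

variable [MeasurableSpace K]

/-- A solution, possibly zero, of `-Δ_μ u = lam * u` that vanishes on the boundary together with
its normal derivatives. -/
structure IsLocalized (μ : Measure K) (lam : ℝ) (u : C(K, ℝ)) : Prop where
  boundary : ∀ p ∈ D.V₀, u p = 0
  laplacian : E.HasLaplacian μ u ((-lam) • u)
  normalDeriv : ∀ p ∈ D.V₀, E.HasNormalDeriv u p 0

variable {E} {μ : Measure K} {lam : ℝ}

theorem IsPreLocalized.isLocalized {u : C(K, ℝ)} (h : E.IsPreLocalized μ lam u) :
    E.IsLocalized μ lam u := by
  obtain ⟨⟨-, f, hf, hfu⟩, hb, hn⟩ := h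
  refine ⟨hb, fun ε hε => ?_, hn⟩
  filter_upwards [hf ε hε] with m hm p hp
  have h1 : ((-lam) • u) p = f p := by
    rw [ContinuousMap.smul_apply, smul_eq_mul, neg_mul, ← hfu p hp.2, neg_neg]
  rw [h1]
  exact hm p hp

theorem IsLocalized.isEigenfunction {u : C(K, ℝ)} (h : E.IsLocalized μ lam u) (hu : u ≠ 0) :
    E.IsEigenfunction μ lam u :=
  ⟨hu, _, h.laplacian, fun x _ => by simp⟩

theorem isLocalized_zero : E.IsLocalized μ lam 0 where
  boundary _ _ := rfl
  laplacian ε hε := Eventually.of_forall fun m p _ => by rw [Hm_zero]; simpa using hε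
  normalDeriv p _ := by
    simp only [HasNormalDeriv, Hm_zero, neg_zero]
    exact tendsto_const_nhds

theorem IsLocalized.neg {u : C(K, ℝ)} (h : E.IsLocalized μ lam u) : E.IsLocalized μ lam (-u) where
  boundary p hp := by simp [h.boundary p hp]
  laplacian ε hε := by
    filter_upwards [h.laplacian ε hε] with m hm p hp
    have := hm p hp
    rw [← abs_neg] at this
    rw [Hm_neg]
    convert this using 2
    simp
    ring
  normalDeriv p hp := by
    have := (h.normalDeriv p hp).neg
    rw [neg_zero] at this
    exact this.congr fun m => by rw [Hm_neg]

variable [ConnectedSpace K] [BorelSpace K] {M : ProbWeights s}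

/-- The decay of the discrete normal derivatives: not only do they tend to `0`, they do so faster
than the masses of the tent functions. By summation by parts, `H_m u (p)` is the limit of sums of
`ψ_{m,p} H_n u` over the vertices of level `n`; there `H_n u` is the mass times nearly `- lam * u`,
which is small near `p`. -/
theorem IsLocalized.eventually_abs_Hm_le (hμ : D.IsSelfSimilarMeasure M μ) {u : C(K, ℝ)}
    (h : E.IsLocalized μ lam u) {ε : ℝ} (hε : 0 < ε) :
    ∀ᶠ m in atTop, ∀ p ∈ D.V₀, |E.Hm m u p| ≤ ε * ∫ x, E.tent m p x ∂μ := by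
  classical
  have := hμ.1
  obtain ⟨c, hc1, hc⟩ := D.exists_ratio
  have huc : UniformContinuous (lam • u) :=
    CompactSpace.uniformContinuous_of_continuous (lam • u).continuous
  obtain ⟨δ, hδ, hu⟩ := Metric.uniformContinuous_iff.1 huc (ε / 2) (by positivity)
  filter_upwards [(SelfSimilarSet.tendsto_ratio_pow_mul_diam (K := K) hc1).eventually
    (gt_mem_nhds hδ)]
    with m hm p hp
  have hpm : p ∈ D.V m := D.V₀_subset_V m hp
  have hn0 : Tendsto (fun n => |E.Hm n u p| + ε * ∫ x, E.tent m p x ∂μ) atTop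
      (𝓝 (ε * ∫ x, E.tent m p x ∂μ)) := by
    have := (h.normalDeriv p hp).abs.add_const (ε * ∫ x, E.tent m p x ∂μ)
    simpa using this
  refine ge_of_tendsto hn0 ?_
  filter_upwards [eventually_ge_atTop m, h.laplacian (ε / 2) (by positivity)] with n hmn hn
  have hsum : E.Hm m u p =
      ∑ q ∈ (D.finite_V n).toFinset, E.tent m p q * E.Hm n u q := by
    have h1 : E.form m u (indicator {p} 1) = E.form m u (E.tent m p) :=
      E.form_congr (fun _ _ => rfl) (E.tent_spec hpm).2.symm
    rw [Hm_eq_neg_form, h1, form_comm, ← (E.tent_spec hpm).1.form_eq hmn, form_comm,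
      form_eq_neg_sum_Hm, neg_neg]
  have hpn : p ∈ (D.finite_V n).toFinset := (D.finite_V n).mem_toFinset.2 (D.V₀_subset_V n hp)
  rw [hsum, ← Finset.add_sum_erase _ _ hpn, E.tent_self hpm, one_mul]
  refine (abs_add_le _ _).trans (add_le_add_right ?_ _)
  have hterm : ∀ q ∈ (D.finite_V n).toFinset.erase p, |E.tent m p q * E.Hm n u q| ≤
      ε * (E.tent m p q * ∫ x, E.tent n q x ∂μ) := by
    intro q hq
    rw [Finset.mem_erase, (D.finite_V n).mem_toFinset] at hq
    have hT := E.integral_tent_pos hμ hq.2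
    by_cases h0 : E.tent m p q = 0
    · simp [h0]
    have hq0 : q ∉ D.V₀ := fun hq0 => h0 <| by
      rw [(E.tent_spec hpm).2 (D.V₀_subset_V m hq0)]
      simp [hq.1]
    have h1 := hn q ⟨hq.2, hq0⟩
    have h2 : |lam * u q| < ε / 2 := by
      have := hu ((E.dist_le_of_tent_ne_zero hc hpm h0).trans_lt hm)
      simpa [Real.dist_eq, h.boundary p hp] using this
    rw [ContinuousMap.smul_apply, smul_eq_mul, neg_mul, sub_neg_eq_add] at h1
    have h3 : |(∫ x, E.tent n q x ∂μ)⁻¹ * E.Hm n u q| ≤ ε := by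
      rw [abs_lt] at h1 h2
      rw [abs_le]
      constructor <;> linarith [h1.1, h1.2, h2.1, h2.2]
    rw [abs_mul, abs_inv, abs_of_pos hT, inv_mul_le_iff₀ hT] at h3
    rw [abs_mul, abs_of_nonneg (E.tent_nonneg hpm q)]
    calc _ ≤ E.tent m p q * ((∫ x, E.tent n q x ∂μ) * ε) :=
          mul_le_mul_of_nonneg_left h3 (E.tent_nonneg hpm q)
      _ = _ := by ring
  calc _ ≤ ∑ q ∈ (D.finite_V n).toFinset.erase p, |E.tent m p q * E.Hm n u q| :=
        Finset.abs_sum_le_sum_abs _ _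
    _ ≤ ∑ q ∈ (D.finite_V n).toFinset.erase p, ε * (E.tent m p q * ∫ x, E.tent n q x ∂μ) :=
        Finset.sum_le_sum hterm
    _ ≤ ∑ q ∈ (D.finite_V n).toFinset, ε * (E.tent m p q * ∫ x, E.tent n q x ∂μ) :=
        Finset.sum_le_sum_of_subset_of_nonneg (Finset.erase_subset _ _) fun q hq _ =>
          mul_nonneg hε.le (mul_nonneg (E.tent_nonneg hpm q)
            (E.integral_tent_pos hμ ((D.finite_V n).mem_toFinset.1 hq)).le)
    _ = ε * ∫ x, E.tent m p x ∂μ := by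
        rw [← Finset.mul_sum, E.sum_tent_mul_integral hmn hpm]

/-- Gluing scaled copies: if each `v i` is a localized solution with eigenvalue `r_i μ_i lam`, then
the function that is `v i ∘ F_i⁻¹` on the cell `F_i K` is one with eigenvalue `lam`. At interior
vertices of a cell this is scaling; at the junction points the function vanishes, and the decay of
the discrete normal derivatives of the pieces is what is needed. -/
theorem IsLocalized.of_comp_F (hμ : D.IsSelfSimilarMeasure M μ) {u : C(K, ℝ)}
    {v : Fin s → C(K, ℝ)} (huv : ∀ i x, u (D.F i x) = v i x)
    (hv : ∀ i, E.IsLocalized μ (E.r i * M.wt i * lam) (v i)) : E.IsLocalized μ lam u where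
  boundary p hp := by
    obtain ⟨i, q, hq, rfl⟩ := D.exists_F_eq_of_mem_V₀ hp
    rw [huv, (hv i).boundary q hq]
  normalDeriv p hp := by
    rw [HasNormalDeriv, ← tendsto_add_atTop_iff_nat 1]
    simp only [E.Hm_succ _ huv]
    have key : ∀ i, Tendsto (fun m => (E.r i)⁻¹ * -E.form m (v i)
        (indicator {p} (1 : K → ℝ) ∘ D.F i)) atTop (𝓝 0) := by
      intro i
      rw [← mul_zero (E.r i)⁻¹]
      refine Tendsto.const_mul _ ?_
      by_cases hq : ∃ q, D.F i q = p
      · obtain ⟨q, hq⟩ := hq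
        have := ((hv i).normalDeriv q (D.mem_V₀_of_F_mem_V₀ (hq ▸ hp))).neg
        rw [neg_zero] at this
        refine this.congr fun m => ?_
        rw [indicator_comp_F hq, ← Hm_eq_neg_form, neg_neg]
      · push Not at hq
        have : (indicator {p} (1 : K → ℝ)) ∘ D.F i = 0 := funext fun x => by simp [hq x]
        simp only [this, map_zero, neg_zero]
        exact tendsto_const_nhds
    have := (tendsto_finsetSum Finset.univ fun i _ => key i).neg
    simpa using this
  laplacian ε hε := by
    have ha : ∀ i, 0 < E.r i * M.wt i := fun i => mul_pos (E.r_pos i) (M.pos i)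
    have hε' : ∀ i, 0 < ε / 2 * (E.r i * M.wt i) := fun i => mul_pos (half_pos hε) (ha i)
    rw [← map_add_atTop_eq_nat 1, eventually_map]
    filter_upwards [eventually_all.2 fun i => (hv i).laplacian _ (hε' i),
      eventually_all.2 fun i => (hv i).eventually_abs_Hm_le hμ (hε' i)] with m hL hN p hp
    have hT := E.integral_tent_pos hμ hp.1
    have hTsum := hμ.integral_eq (E.tent (m + 1) p)
    rw [ContinuousMap.smul_apply, smul_eq_mul, neg_mul, sub_neg_eq_add]
    obtain ⟨i, q, hq, hqp⟩ := D.exists_of_mem_V_succ hp.1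
    by_cases hq0 : q ∈ D.V₀
    · -- A junction point: all its preimages are boundary points.
      have hall : ∀ j q', D.F j q' = p → q' ∈ D.V₀ := fun j q' hq' => by
        by_cases hij : j = i
        · subst hij
          rwa [D.injective j (hq'.trans hqp.symm)]
        · exact D.mem_V₀_of_overlap hij (hq'.trans hqp.symm)
      have hup : u p = 0 := by rw [← hqp, huv, (hv i).boundary q hq0]
      have hj : ∀ j, |(E.r j)⁻¹ * -E.form m (v j) (indicator {p} (1 : K → ℝ) ∘ D.F j)| ≤
          ε / 2 * (M.wt j * ∫ x, E.tent (m + 1) p (D.F j x) ∂μ) := by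
        intro j
        by_cases hq' : ∃ q' ∈ D.V m, D.F j q' = p
        · obtain ⟨q', hq', e⟩ := hq'
          have h1 := hN j q' (hall j q' e)
          rw [indicator_comp_F e, ← Hm_eq_neg_form, abs_mul, abs_inv, abs_of_pos (E.r_pos j),
            inv_mul_le_iff₀ (E.r_pos j)]
          simp only [E.tent_comp_F hq' e]
          refine h1.trans (le_of_eq ?_)
          ring
        · push Not at hq'
          have h0 : E.form m (v j) (indicator {p} (1 : K → ℝ) ∘ D.F j) = 0 := by
            rw [E.form_congr (fun _ _ => rfl) (indicator_comp_F_eqOn_zero hq'), map_zero]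
          simp only [E.tent_comp_F_eq_zero hp.1 hq', h0]
          simp
      have hsum : |E.Hm (m + 1) u p| ≤ ε / 2 * ∫ x, E.tent (m + 1) p x ∂μ := by
        rw [E.Hm_succ m huv, hTsum, Finset.mul_sum]
        exact (Finset.abs_sum_le_sum_abs _ _).trans (Finset.sum_le_sum fun j _ => hj j)
      rw [hup, mul_zero, add_zero, abs_mul, abs_inv, abs_of_pos hT, inv_mul_lt_iff₀ hT]
      refine hsum.trans_lt ?_
      rw [mul_comm]
      exact mul_lt_mul_of_pos_left (half_lt_self hε) hT
    · -- An interior vertex of the cell `i`, which lies in no other cell.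
      have hne : ∀ j, j ≠ i → ∀ q' ∈ D.V m, D.F j q' ≠ p := fun j hji q' _ e =>
        hq0 (D.mem_V₀_of_overlap (Ne.symm hji) (hqp.trans e.symm))
      have hH : E.Hm (m + 1) u p = (E.r i)⁻¹ * E.Hm m (v i) q := by
        rw [E.Hm_succ m huv, Finset.sum_eq_single i, indicator_comp_F hqp, ← Hm_eq_neg_form]
        · intro j _ hji
          rw [E.form_congr (fun _ _ => rfl) (indicator_comp_F_eqOn_zero (hne j hji)), map_zero,
            neg_zero, mul_zero]
        · simp
      have hTi : ∫ x, E.tent (m + 1) p x ∂μ = M.wt i * ∫ x, E.tent m q x ∂μ := by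
        rw [hTsum, Finset.sum_eq_single i]
        · simp only [E.tent_comp_F hq hqp]
        · intro j _ hji
          simp only [E.tent_comp_F_eq_zero hp.1 (hne j hji)]
          simp
        · simp
      have h1 := hL i q ⟨hq, hq0⟩
      rw [ContinuousMap.smul_apply, smul_eq_mul, neg_mul, sub_neg_eq_add] at h1
      have h2 : (∫ x, E.tent (m + 1) p x ∂μ)⁻¹ * E.Hm (m + 1) u p + lam * u p =
          (E.r i * M.wt i)⁻¹ * ((∫ x, E.tent m q x ∂μ)⁻¹ * E.Hm m (v i) q +
            E.r i * M.wt i * lam * v i q) := by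
        rw [hH, hTi, ← hqp, huv, mul_inv, mul_inv]
        have := (E.r_pos i).ne'
        have := (M.pos i).ne'
        field_simp
      rw [h2, abs_mul, abs_inv, abs_of_pos (ha i), inv_mul_lt_iff₀ (ha i)]
      refine h1.trans ?_
      rw [mul_comm]
      exact mul_lt_mul_of_pos_left (half_lt_self hε) (ha i)

end RegularHarmonicStructure

/-! ### Counting peaks -/

/-- `u ≤ c`, and the level set `{u = c}` has at least `k` connected components: it contains `k`
points no two of which lie in a common preconnected subset. -/
structure HasPeaks {K : Type*} [TopologicalSpace K] (c : ℝ) (k : ℕ) (u : C(K, ℝ)) : Prop where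
  le : ∀ x, u x ≤ c
  exists_finset : ∃ S : Finset K, k ≤ S.card ∧ (∀ x ∈ S, u x = c) ∧
    ∀ B ⊆ u ⁻¹' {c}, IsPreconnected B → ∀ x ∈ S, ∀ y ∈ S, x ∈ B → y ∈ B → x = y

theorem hasPeaks_zero {K : Type*} [TopologicalSpace K] {c : ℝ} (hc : 0 ≤ c) :
    HasPeaks c 0 (0 : C(K, ℝ)) :=
  ⟨fun _ => hc, ∅, le_rfl, by simp, by simp⟩

section Peaks

variable {s : ℕ} {K : Type*} [MetricSpace K] [CompactSpace K] [Nonempty K] {c : ℝ}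

/-- Peaks in different cells add up, because the glued function vanishes where cells meet. -/
theorem HasPeaks.of_comp_F (D : SelfSimilarSet s K) (hc : 0 < c) {u : C(K, ℝ)}
    {v : Fin s → C(K, ℝ)} {k : Fin s → ℕ} (huv : ∀ i x, u (D.F i x) = v i x)
    (hb : ∀ i, ∀ p ∈ D.V₀, v i p = 0) (hv : ∀ i, HasPeaks c (k i) (v i)) :
    HasPeaks c (∑ i, k i) u := by
  classical
  choose S hcard hSc hS using fun i => (hv i).exists_finset
  -- A point of height `c` lies in only one cell.
  have huniq : ∀ i j x y, u (D.F i x) = c → D.F i x = D.F j y → i = j := by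
    intro i j x y hx e
    by_contra hij
    rw [huv, hb i x (D.mem_V₀_of_overlap hij e)] at hx
    exact hc.ne hx
  refine ⟨fun x => ?_, Finset.univ.biUnion fun i => (S i).image (D.F i), ?_, ?_, ?_⟩
  · obtain ⟨i, y, rfl⟩ := D.exists_eq_F x
    rw [huv]
    exact (hv i).le y
  · rw [Finset.card_biUnion]
    · refine Finset.sum_le_sum fun i _ => ?_
      rw [Finset.card_image_of_injective _ (D.injective i)]
      exact hcard i
    · intro i _ j _ hij
      rw [Function.onFun, Finset.disjoint_left]
      intro z hz hz'
      obtain ⟨x, hx, rfl⟩ := Finset.mem_image.1 hz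
      obtain ⟨y, -, e⟩ := Finset.mem_image.1 hz'
      exact hij (huniq i j x y ((huv i x).trans (hSc i x hx)) e.symm)
  · intro z hz
    obtain ⟨i, -, hz⟩ := Finset.mem_biUnion.1 hz
    obtain ⟨x, hx, rfl⟩ := Finset.mem_image.1 hz
    exact (huv i x).trans (hSc i x hx)
  · intro B hBc hB z hz z' hz' hzB hzB'
    obtain ⟨i, -, hz⟩ := Finset.mem_biUnion.1 hz
    obtain ⟨x, hx, rfl⟩ := Finset.mem_image.1 hz
    obtain ⟨j, -, hz'⟩ := Finset.mem_biUnion.1 hz'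
    obtain ⟨y, hy, rfl⟩ := Finset.mem_image.1 hz'
    have hclF : ∀ l, IsClosed (range (D.F l)) := fun l =>
      (isCompact_range (D.continuous_F l)).isClosed
    have hcl : IsClosed (⋃ l ∈ {l | l ≠ i}, range (D.F l)) :=
      (toFinite _).isClosed_biUnion fun l _ => hclF l
    have hcov : B ⊆ range (D.F i) ∪ ⋃ l ∈ {l | l ≠ i}, range (D.F l) := by
      intro w _
      obtain ⟨l, a, rfl⟩ := D.exists_eq_F w
      by_cases hl : l = i
      · exact Or.inl (hl ▸ ⟨a, rfl⟩)
      · exact Or.inr (mem_biUnion (x := l) hl ⟨a, rfl⟩)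
    -- So a connected subset of the level set stays in one cell.
    have hsub : B ⊆ range (D.F i) := by
      intro w hw
      by_contra hwi
      obtain ⟨w', hw', ⟨a, rfl⟩, h2⟩ := isPreconnected_closed_iff.1 hB _ _ (hclF i) hcl hcov
        ⟨_, hzB, ⟨x, rfl⟩⟩ ⟨w, hw, (hcov hw).resolve_left hwi⟩
      obtain ⟨l, hl, b, e⟩ := mem_iUnion₂.1 h2
      exact hl (huniq i l a b (hBc hw') e.symm).symm
    obtain ⟨y', hy'⟩ := hsub hzB'
    obtain rfl := huniq j i y y' ((huv j y).trans (hSc j y hy)) hy'.symm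
    have hpre := hB.preimage_of_isClosedMap (D.injective j) (D.continuous_F j).isClosedMap hsub
    have hxy := hS j _ (fun w hw => (huv j w).symm.trans (hBc hw)) hpre x hx y hy hzB hzB'
    rw [hxy]

/-- Peaks of a function that vanishes on the boundary are extreme sets. -/
theorem HasPeaks.le_numExtreme (D : PCFSet s K) (hc : 0 < c) {u : C(K, ℝ)} {k : ℕ}
    (h : HasPeaks c k u) (hb : ∀ p ∈ D.V₀, u p = 0) : (k : ℕ∞) ≤ D.numExtreme u := by
  obtain ⟨hle, S, hcard, hSc, hS⟩ := h
  have hinj : InjOn (connectedComponentIn (u ⁻¹' {c})) (S : Set K) := by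
    intro x hx y hy e
    refine hS _ (connectedComponentIn_subset _ x) isPreconnected_connectedComponentIn x hx y hy
      (mem_connectedComponentIn (hSc x hx)) ?_
    rw [e]
    exact mem_connectedComponentIn (hSc y hy)
  calc (k : ℕ∞) ≤ (S : Set K).encard := by
        rw [encard_coe_eq_coe_finsetCard]
        exact_mod_cast hcard
    _ = (connectedComponentIn (u ⁻¹' {c}) '' S).encard := hinj.encard_image.symm
    _ ≤ D.numExtreme u := by
        refine encard_le_encard ?_
        rintro _ ⟨x, hx, rfl⟩
        refine ⟨c, ⟨x, hSc x hx, rfl⟩, ?_, 1, one_pos, Or.inl fun p _ => hle p⟩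
        rw [eq_empty_iff_forall_notMem]
        rintro p ⟨hp, hp₀⟩
        have : p ∈ u ⁻¹' {c} := connectedComponentIn_subset _ _ hp
        rw [mem_preimage, mem_singleton_iff, hb p hp₀] at this
        exact hc.ne this

end Peaks

namespace RegularHarmonicStructure

variable {s : ℕ} {K : Type*} [MetricSpace K] [CompactSpace K] [Nonempty K] {D : PCFSet s K}
  (E : RegularHarmonicStructure D) [MeasurableSpace K] (μ : Measure K)

/-- There is a localized solution with eigenvalue `lam` that has `k` peaks of height `c`. -/
def PeaksAt (c lam : ℝ) (k : ℕ) : Prop := ∃ u, E.IsLocalized μ lam u ∧ HasPeaks c k u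

variable {E μ} {c lam : ℝ}

theorem IsPreLocalized.exists_peaksAt {u : C(K, ℝ)} (h : E.IsPreLocalized μ lam u) :
    ∃ c, 0 < c ∧ E.PeaksAt μ c lam 1 := by
  have key : ∀ v : C(K, ℝ), E.IsLocalized μ lam v → (∃ x, 0 < v x) →
      ∃ c, 0 < c ∧ E.PeaksAt μ c lam 1 := by
    rintro v hv ⟨x, hx⟩
    obtain ⟨z, -, hz⟩ := isCompact_univ.exists_isMaxOn univ_nonempty v.continuous.continuousOn
    refine ⟨v z, hx.trans_le (hz (mem_univ x)), v, hv, fun y => hz (mem_univ y), {z}, by simp,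
      by simp, ?_⟩
    intro B _ _ a ha b hb _ _
    rw [Finset.mem_singleton.1 ha, Finset.mem_singleton.1 hb]
  obtain ⟨x, hx⟩ : ∃ x, u x ≠ 0 := by
    by_contra hne
    push Not at hne
    exact h.1.1 (ContinuousMap.ext hne)
  rcases hx.lt_or_gt with hx | hx
  · exact key (-u) h.isLocalized.neg ⟨x, by simpa using hx⟩
  · exact key u h.isLocalized ⟨x, hx⟩

theorem peaksAt_zero (hc : 0 < c) : E.PeaksAt μ c lam 0 :=
  ⟨0, isLocalized_zero, hasPeaks_zero hc.le⟩

theorem PeaksAt.le_extremumCount (hc : 0 < c) {k : ℕ} (h : E.PeaksAt μ c lam k) (h0 : 0 ≤ lam)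
    {x : ℝ} (hx : lam ≤ x) : (k : ℕ∞) ≤ E.extremumCount μ x := by
  rcases k.eq_zero_or_pos with rfl | hk
  · simp
  obtain ⟨u, hu, hp⟩ := h
  have hne : u ≠ 0 := by
    rintro rfl
    obtain ⟨-, S, hS, hSc, -⟩ := hp
    obtain ⟨x, hx⟩ := Finset.card_pos.1 (hk.trans_le hS)
    exact hc.ne (hSc x hx)
  exact (hp.le_numExtreme D hc hu.boundary).trans
    (le_sSup ⟨lam, u, h0, hx, hu.isEigenfunction hne, rfl⟩)

variable [ConnectedSpace K] [BorelSpace K] {M : ProbWeights s}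

theorem PeaksAt.sum (hμ : D.IsSelfSimilarMeasure M μ) (hc : 0 < c) {k : Fin s → ℕ}
    (h : ∀ i, E.PeaksAt μ c (E.r i * M.wt i * lam) (k i)) : E.PeaksAt μ c lam (∑ i, k i) := by
  choose v hv hp using h
  obtain ⟨u, hu⟩ := D.exists_glue v (D.compatible_of_boundary fun i j x hx y hy _ => by
    rw [(hv i).boundary x hx, (hv j).boundary y hy])
  exact ⟨u, .of_comp_F hμ hu hv,
    .of_comp_F D.toSelfSimilarSet hc hu (fun i => (hv i).boundary) hp⟩

theorem PeaksAt.pair (hμ : D.IsSelfSimilarMeasure M μ) (hc : 0 < c) {i j : Fin s} (hij : i ≠ j)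
    {k l : ℕ} (hi : E.PeaksAt μ c (E.r i * M.wt i * lam) k)
    (hj : E.PeaksAt μ c (E.r j * M.wt j * lam) l) : E.PeaksAt μ c lam (k + l) := by
  have := PeaksAt.sum (lam := lam) hμ hc (k := Pi.single i k + Pi.single j l) (E := E) fun a => by
    by_cases hai : a = i
    · subst hai
      simpa [hij] using hi
    by_cases haj : a = j
    · subst haj
      simpa [hai] using hj
    simpa [hai, haj] using peaksAt_zero hc
  simpa [Finset.sum_add_distrib] using this

/-- Placing two copies of a solution in the cells with words `ij` and `ji`, whose scaling factors
agree, doubles the number of peaks. -/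
theorem PeaksAt.double (hμ : D.IsSelfSimilarMeasure M μ) (hc : 0 < c) {i j : Fin s} (hij : i ≠ j)
    {k : ℕ} (h : E.PeaksAt μ c (E.r i * M.wt i * (E.r j * M.wt j) * lam) k) :
    E.PeaksAt μ c lam (2 * k) := by
  rw [two_mul]
  refine .pair hμ hc hij ?_ ?_
  · refine .pair (l := 0) hμ hc hij.symm ?_ (peaksAt_zero hc)
    convert h using 1
    ring
  · refine .pair (l := 0) hμ hc hij ?_ (peaksAt_zero hc)
    convert h using 1
    ring

end RegularHarmonicStructure

/-! ### A renewal sequence -/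

section Renewal

variable {s : ℕ}

/-- The number of words with total weight `n`, if the symbol `i` has weight `ν i + 1`. -/
def weightedWordCount (ν : Fin s → ℕ) : ℕ → ℕ
  | 0 => 1
  | n + 1 => ∑ i, if ν i ≤ n then weightedWordCount ν (n - ν i) else 0
  termination_by n => n
  decreasing_by omega

/-- The conserved quantity of the renewal equation: the total weight of the words that first cross
a given level. -/
theorem renewal_conservation (ν : Fin s → ℕ) (p : Fin s → ℝ) (hp : ∑ i, p i = 1) (b : ℕ → ℝ)
    (h0 : b 0 = 1) (hb : ∀ n, b (n + 1) = ∑ i, p i * if ν i ≤ n then b (n - ν i) else 0) (n : ℕ) :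
    ∑ i, p i * ∑ j ∈ Finset.range (ν i + 1), (if j ≤ n then b (n - j) else 0) = 1 := by
  induction n with
  | zero =>
    rw [← hp]
    refine Finset.sum_congr rfl fun i _ => ?_
    rw [Finset.sum_range_succ']
    simp [h0]
  | succ n ih =>
    have hstep : ∀ i, ∑ j ∈ Finset.range (ν i + 1), (if j ≤ n + 1 then b (n + 1 - j) else 0) =
        ∑ j ∈ Finset.range (ν i + 1), (if j ≤ n then b (n - j) else 0) +
          (b (n + 1) - if ν i ≤ n then b (n - ν i) else 0) := by
      intro i
      rw [Finset.sum_range_succ', Finset.sum_range_succ]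
      simp only [Nat.add_le_add_iff_right, Nat.add_sub_add_right, Nat.zero_le, if_true,
        Nat.sub_zero]
      ring
    simp only [hstep, mul_add, Finset.sum_add_distrib, ih, mul_sub, Finset.sum_sub_distrib,
      ← Finset.sum_mul, hp, one_mul]
    rw [← hb, sub_self, add_zero]

/-- A renewal sequence is bounded below along a sequence with bounded gaps. -/
theorem exists_renewal_lower_bound (ν : Fin s → ℕ) (p : Fin s → ℝ) (hp0 : ∀ i, 0 ≤ p i)
    (hp : ∑ i, p i = 1) (b : ℕ → ℝ) (h0 : b 0 = 1)
    (hb : ∀ n, b (n + 1) = ∑ i, p i * if ν i ≤ n then b (n - ν i) else 0) :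
    ∃ L : ℕ, 0 < L ∧ ∀ n, ∃ k ≤ n, n < k + L ∧ 1 / (2 * L : ℝ) ≤ b k := by
  refine ⟨∑ i, ν i + 1, Nat.succ_pos _, fun n => ?_⟩
  set L := ∑ i, ν i + 1 with hL
  have hLpos : (0 : ℝ) < L := by positivity
  by_contra hcon
  push Not at hcon
  have hle : ∀ i, ∑ j ∈ Finset.range (ν i + 1), (if j ≤ n then b (n - j) else 0) ≤ 1 / 2 := by
    intro i
    have hνL : ν i + 1 ≤ L := by
      rw [hL]
      exact Nat.succ_le_succ (Finset.single_le_sum (fun _ _ => Nat.zero_le _) (Finset.mem_univ i))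
    have hterm : ∀ j ∈ Finset.range (ν i + 1),
        (if j ≤ n then b (n - j) else 0) ≤ 1 / (2 * L : ℝ) := by
      intro j hj
      rw [Finset.mem_range] at hj
      split_ifs with hjn
      · exact (hcon (n - j) (Nat.sub_le _ _) (by omega)).le
      · positivity
    refine (Finset.sum_le_card_nsmul _ _ _ hterm).trans ?_
    rw [Finset.card_range, nsmul_eq_mul]
    calc ((ν i + 1 : ℕ) : ℝ) * (1 / (2 * L)) ≤ L * (1 / (2 * L)) := by gcongr
      _ = 1 / 2 := by field_simp
  have h1 := renewal_conservation ν p hp b h0 hb n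
  have h2 : ∑ i, p i * ∑ j ∈ Finset.range (ν i + 1), (if j ≤ n then b (n - j) else 0) ≤
      ∑ i, p i * (1 / 2) :=
    Finset.sum_le_sum fun i _ => mul_le_mul_of_nonneg_left (hle i) (hp0 i)
  rw [← Finset.sum_mul, hp] at h2
  linarith

end Renewal

/-! ### Growth of the extremum counting function -/

namespace RegularHarmonicStructure

variable {s : ℕ} {K : Type*} [MetricSpace K] [CompactSpace K] [Nonempty K] {D : PCFSet s K}
  (E : RegularHarmonicStructure D) (M : ProbWeights s)

theorem sum_γ_rpow_spectralExponent : ∑ i, E.γ M i ^ E.spectralExponent M = 1 :=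
  (E.existsUnique_spectralExponent M).choose_spec.1

theorem γ_pos (i : Fin s) : 0 < E.γ M i := Real.sqrt_pos.2 (mul_pos (E.r_pos i) (M.pos i))

theorem scaling_lt_one (i : Fin s) : E.r i * M.wt i < 1 :=
  mul_lt_one_of_nonneg_of_lt_one_left (E.r_pos i).le (E.r_lt_one i) (M.lt_one i).le

theorem γ_lt_one (i : Fin s) : E.γ M i < 1 :=
  (Real.sqrt_lt' one_pos).2 (by simpa using E.scaling_lt_one M i)

theorem γ_sq (i : Fin s) : E.γ M i ^ 2 = E.r i * M.wt i :=
  Real.sq_sqrt (mul_pos (E.r_pos i) (M.pos i)).le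

theorem spectralExponent_pos : 0 < E.spectralExponent M := by
  by_contra hd
  push Not at hd
  have h1 : ∑ _i : Fin s, (1 : ℝ) ≤ ∑ i, E.γ M i ^ E.spectralExponent M :=
    Finset.sum_le_sum fun i _ =>
      Real.one_le_rpow_of_pos_of_le_one_of_nonpos (E.γ_pos M i) (E.γ_lt_one M i).le hd
  rw [sum_γ_rpow_spectralExponent] at h1
  have hs := D.two_le
  simp at h1
  omega

variable {E M}

/-- In the lattice case all `log γ_i` are negative multiples of one positive number. -/
theorem IsLattice.exists_log_eq (h : E.IsLattice M) :
    ∃ c : ℝ, 0 < c ∧ ∃ ν : Fin s → ℕ, ∀ i, Real.log (E.γ M i) = -(c * (ν i + 1)) := by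
  obtain ⟨g, hg⟩ := (AddSubgroup.isAddCyclic_iff_exists_zmultiples_eq_top _).1
    (AddSubgroup.discrete_iff_addCyclic.2 h)
  have hmem : ∀ i, ∃ z : ℤ, z • g = Real.log (E.γ M i) := fun i => by
    rw [← AddSubgroup.mem_zmultiples_iff, hg]
    exact AddSubgroup.subset_closure ⟨i, rfl⟩
  choose z hz using hmem
  have hneg : ∀ i, Real.log (E.γ M i) < 0 := fun i => Real.log_neg (E.γ_pos M i) (E.γ_lt_one M i)
  have hs := D.two_le
  have hg0 : g ≠ 0 := by
    rintro rfl
    have := hz ⟨0, by omega⟩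
    rw [smul_zero] at this
    exact (hneg _).ne this.symm
  refine ⟨|g|, abs_pos.2 hg0, fun i => (z i).natAbs - 1, fun i => ?_⟩
  have hz0 : z i ≠ 0 := fun h0 => by
    have := hz i
    rw [h0, zero_smul] at this
    exact (hneg i).ne this.symm
  have hz1 : 1 ≤ (z i).natAbs := Int.natAbs_pos.2 hz0
  rw [Nat.cast_sub hz1, Nat.cast_one, sub_add_cancel, Nat.cast_natAbs, Int.cast_abs, ← abs_mul,
    mul_comm, ← zsmul_eq_mul, hz, abs_of_neg (hneg i), neg_neg]

/-- The number of words of total weight `n` grows like `exp (a * d_S * n)`, along a sequence of `n`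
with bounded gaps. -/
theorem exists_weightedWordCount_lower_bound {a : ℝ} {ν : Fin s → ℕ}
    (hν : ∀ i, Real.log (E.γ M i) = -(a * (ν i + 1))) :
    ∃ L : ℕ, 0 < L ∧ ∀ n, ∃ k ≤ n, n < k + L ∧
      Real.exp (a * E.spectralExponent M * k) / (2 * L) ≤ weightedWordCount ν k := by
  set d := E.spectralExponent M with hd
  have hp : ∀ i, E.γ M i ^ d = Real.exp (-(a * d * (ν i + 1))) := fun i => by
    rw [Real.rpow_def_of_pos (E.γ_pos M i), hν]
    ring_nf
  obtain ⟨L, hL, h⟩ := exists_renewal_lower_bound ν (fun i => E.γ M i ^ d)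
    (fun i => (Real.rpow_pos_of_pos (E.γ_pos M i) d).le) (E.sum_γ_rpow_spectralExponent M)
    (fun n => weightedWordCount ν n * Real.exp (-(a * d * n))) (by simp [weightedWordCount])
    fun n => by
      rw [weightedWordCount]
      push_cast
      rw [Finset.sum_mul]
      refine Finset.sum_congr rfl fun i _ => ?_
      split_ifs with hi
      · rw [hp, mul_left_comm, ← Real.exp_add, Nat.cast_sub hi]
        ring_nf
      · simp
  refine ⟨L, hL, fun n => ?_⟩
  obtain ⟨k, hkn, hnk, hk⟩ := h n
  refine ⟨k, hkn, hnk, ?_⟩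
  rw [Real.exp_neg, ← div_eq_mul_inv, le_div_iff₀ (Real.exp_pos _)] at hk
  rw [div_eq_mul_one_div, mul_comm]
  exact hk

/-- Every large `x` lies above an eigenvalue of the form `lam * exp (L * n)` that is comparable to
it. -/
theorem eventually_exists_exp_le (lam : ℝ) {L : ℝ} (hL : 0 < L) :
    ∃ B : ℝ, ∀ᶠ x : ℝ in atTop, ∃ n : ℕ,
      (∀ k ≤ n, lam * Real.exp (L * k) ≤ x) ∧ Real.log x ≤ B + L * n := by
  set b := Real.log (max lam 1)
  have hb0 : (0 : ℝ) < max lam 1 := lt_max_of_lt_right one_pos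
  refine ⟨b + L, ?_⟩
  filter_upwards [eventually_ge_atTop (max lam 1)] with x hx
  have hx0 : 0 < x := hb0.trans_le hx
  have hbx : b ≤ Real.log x := Real.log_le_log hb0 hx
  refine ⟨⌊(Real.log x - b) / L⌋₊, fun k hk => ?_, ?_⟩
  · have h1 : (k : ℝ) ≤ (Real.log x - b) / L :=
      (Nat.le_floor_iff (div_nonneg (sub_nonneg.2 hbx) hL.le)).1 hk
    rw [le_div_iff₀ hL] at h1
    calc lam * Real.exp (L * k) ≤ Real.exp b * Real.exp (L * k) := by
          rw [Real.exp_log hb0]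
          gcongr
          exact le_max_left _ _
      _ = Real.exp (b + L * k) := (Real.exp_add _ _).symm
      _ ≤ Real.exp (Real.log x) := Real.exp_le_exp.2 (by linarith)
      _ = x := Real.exp_log hx0
  · have h1 := (Nat.lt_floor_add_one ((Real.log x - b) / L)).le
    rw [div_le_iff₀ hL] at h1
    linarith

variable [ConnectedSpace K] [MeasurableSpace K] [BorelSpace K] {μ : Measure K}

theorem peaksAt_two_pow (hμ : D.IsSelfSimilarMeasure M μ) {c lam : ℝ} (hc : 0 < c)
    (h : E.PeaksAt μ c lam 1) : ∃ L : ℝ, 0 < L ∧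
      ∀ n : ℕ, E.PeaksAt μ c (lam * Real.exp (L * n)) (2 ^ n) := by
  have hs := D.two_le
  set i : Fin s := ⟨0, by omega⟩
  set j : Fin s := ⟨1, by omega⟩
  have hij : i ≠ j := by simp [i, j]
  have hpos : ∀ i, 0 < E.r i * M.wt i := fun i => mul_pos (E.r_pos i) (M.pos i)
  set ρ := E.r i * M.wt i * (E.r j * M.wt j) with hρ
  have hρ0 : 0 < ρ := mul_pos (hpos i) (hpos j)
  have hρ1 : ρ < 1 := mul_lt_one_of_nonneg_of_lt_one_left (hpos i).le (E.scaling_lt_one M i)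
    (E.scaling_lt_one M j).le
  refine ⟨-Real.log ρ, neg_pos.2 (Real.log_neg hρ0 hρ1), fun n => ?_⟩
  induction n with
  | zero => simpa using h
  | succ n ih =>
    rw [pow_succ']
    refine .double hμ hc hij ?_
    convert ih using 1
    rw [← hρ, Nat.cast_succ, mul_add, mul_one, Real.exp_add, Real.exp_neg (Real.log ρ),
      Real.exp_log hρ0]
    field_simp

theorem peaksAt_weightedWordCount (hμ : D.IsSelfSimilarMeasure M μ) {c lam a : ℝ} (hc : 0 < c)
    (h : E.PeaksAt μ c lam 1) {ν : Fin s → ℕ}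
    (hν : ∀ i, Real.log (E.γ M i) = -(a * (ν i + 1))) (n : ℕ) :
    E.PeaksAt μ c (lam * Real.exp (2 * a * n)) (weightedWordCount ν n) := by
  induction n using Nat.strong_induction_on with
  | _ n ih =>
    rcases n with _ | n
    · simpa [weightedWordCount] using h
    rw [weightedWordCount]
    refine PeaksAt.sum hμ hc fun i => ?_
    split_ifs with hi
    · convert ih (n - ν i) (by omega) using 1
      rw [← E.γ_sq M i, ← Real.exp_log (E.γ_pos M i), hν, ← Real.exp_nat_mul, Nat.cast_sub hi,
        mul_left_comm, ← Real.exp_add]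
      push_cast
      ring_nf
    · exact peaksAt_zero hc

end RegularHarmonicStructure

theorem proposition1p3 {s : ℕ} {K : Type*} [MetricSpace K] [CompactSpace K] [ConnectedSpace K]
    [MeasurableSpace K] [BorelSpace K] (D : PCFSet s K) (E : RegularHarmonicStructure D)
    (M : ProbWeights s) (μ : Measure K) (hμ : D.IsSelfSimilarMeasure M μ)
    (hpre : ∃ (lam : ℝ) (u : C(K, ℝ)), 0 ≤ lam ∧ E.IsPreLocalized μ lam u) :
    (∃ κ : ℝ, 0 < κ ∧ κ ≤ E.spectralExponent M / 2 ∧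
      (κ : EReal) ≤ liminf (fun x : ℝ =>
        ENNReal.log (E.extremumCount μ x : ℝ≥0∞) / (Real.log x : EReal)) atTop) ∧
    (E.IsLattice M →
      0 < liminf (fun x : ℝ => (E.extremumCount μ x : ℝ≥0∞) /
        ENNReal.ofReal (x ^ (E.spectralExponent M / 2))) atTop) := by
  obtain ⟨lam, u, hlam, hu⟩ := hpre
  obtain ⟨c, hc, hone⟩ := hu.exists_peaksAt
  have hd := E.spectralExponent_pos M
  -- The count in `[0, ∞]` is at least any real number below a number of peaks.
  have hcount : ∀ {lam' x t : ℝ} {k : ℕ}, E.PeaksAt μ c lam' k → 0 ≤ lam' → lam' ≤ x → t ≤ k →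
      ENNReal.ofReal t ≤ (E.extremumCount μ x : ℝ≥0∞) := by
    intro lam' x t k hk h0 hx ht
    have h1 := ENat.toENNReal_le.2 (hk.le_extremumCount hc h0 hx)
    rw [ENat.toENNReal_coe] at h1
    refine le_trans ?_ h1
    rw [← ENNReal.ofReal_natCast]
    exact ENNReal.ofReal_le_ofReal ht
  constructor
  · obtain ⟨L, hL, hpeaks⟩ := RegularHarmonicStructure.peaksAt_two_pow hμ hc hone
    have hlog2 : 0 < Real.log 2 := Real.log_pos one_lt_two
    -- Half of the true growth rate `log 2 / L`, to absorb constants.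
    set κ := min (Real.log 2 / (2 * L)) (E.spectralExponent M / 2)
    have hκ : 0 < κ := lt_min (by positivity) (by positivity)
    refine ⟨κ, hκ, min_le_right _ _, le_liminf_of_le (by isBoundedDefault) ?_⟩
    obtain ⟨B, hB⟩ := RegularHarmonicStructure.eventually_exists_exp_le lam hL
    filter_upwards [hB, eventually_gt_atTop 1,
      Real.tendsto_log_atTop.eventually_ge_atTop (2 * B)] with x hx hx1 hxB
    obtain ⟨n, hn, hxn⟩ := hx
    have hlogx : 0 < Real.log x := Real.log_pos hx1
    have ht : x ^ κ ≤ ((2 ^ n : ℕ) : ℝ) := by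
      rw [Real.rpow_def_of_pos (one_pos.trans hx1)]
      calc Real.exp (Real.log x * κ) ≤ Real.exp (Real.log x * (Real.log 2 / (2 * L))) := by
            gcongr
            exact min_le_left _ _
        _ ≤ Real.exp (n * Real.log 2) := by
            apply Real.exp_le_exp.2
            rw [mul_div_assoc', div_le_iff₀ (by positivity)]
            nlinarith
        _ = ((2 ^ n : ℕ) : ℝ) := by
            rw [Real.exp_nat_mul, Real.exp_log two_pos]
            push_cast
            rfl
    have h1 := ENNReal.log_monotone
      (hcount (hpeaks n) (mul_nonneg hlam (Real.exp_pos _).le) (hn n le_rfl) ht)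
    rw [ENNReal.log_ofReal_of_pos (Real.rpow_pos_of_pos (one_pos.trans hx1) κ),
      Real.log_rpow (one_pos.trans hx1), EReal.coe_mul] at h1
    exact (EReal.le_div_iff_mul_le (by exact_mod_cast hlogx) (EReal.coe_ne_top _)).2 h1
  · intro hlat
    obtain ⟨a, ha, ν, hν⟩ := hlat.exists_log_eq
    obtain ⟨L, hL, hlow⟩ := RegularHarmonicStructure.exists_weightedWordCount_lower_bound hν
    obtain ⟨B, hB⟩ := RegularHarmonicStructure.eventually_exists_exp_le lam
      (by positivity : 0 < 2 * a)
    set d := E.spectralExponent M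
    set C : ℝ := Real.exp (-(d / 2) * (B + 2 * a * L)) / (2 * L)
    have hLr : (0 : ℝ) < L := by exact_mod_cast hL
    have hC : 0 < C := by positivity
    refine (ENNReal.ofReal_pos.2 hC).trans_le (le_liminf_of_le (by isBoundedDefault) ?_)
    filter_upwards [hB, eventually_gt_atTop 0] with x hx hx0
    obtain ⟨n, hn, hxn⟩ := hx
    obtain ⟨k, hkn, hnk, hk⟩ := hlow n
    have hxd : 0 < x ^ (d / 2) := Real.rpow_pos_of_pos hx0 _
    rw [ENNReal.le_div_iff_mul_le (Or.inl (ENNReal.ofReal_pos.2 hxd).ne')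
      (Or.inl ENNReal.ofReal_ne_top), ← ENNReal.ofReal_mul hC.le]
    refine hcount (RegularHarmonicStructure.peaksAt_weightedWordCount hμ hc hone hν k)
      (mul_nonneg hlam (Real.exp_pos _).le) (hn k hkn) (le_trans ?_ hk)
    rw [Real.rpow_def_of_pos hx0, div_mul_eq_mul_div, ← Real.exp_add]
    gcongr
    have hnk' : (n : ℝ) ≤ k + L := by exact_mod_cast hnk.le
    have h2 : Real.log x ≤ B + 2 * a * (k + L) := by nlinarith
    nlinarith
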